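/- **Theorem 5.1 (Trotter–Kato product formula).** Let $(X,d)$ be a complete metric space of finite diameter and let $\lambda_1,\lambda_2\in\mathbb R$. Let $\varphi_1,\varphi_2:X\to(-\infty,\infty]$ be lower semi-continuous functions. Write $D(\psi):=\{\psi<\infty\}$ and $\varphi:=\varphi_1+\varphi_2$. Assume that for $i=1,2$ and every $Q\in\mathbb R$ the bounded subsets of $\{\varphi_i\le Q\}$ are relatively compact. A minimal geodesic is a curve $\gamma:[0,1]\to X$ with $d(\gamma(s),\gamma(t))=|s-t|\,d(\gamma(0),\gamma(1))$ for all $s,t$. A function $\psi:X\to(-\infty,\infty]$ is $\lambda$-convex along $\gamma$ (with endpoints in $D(\psi)$) if $\psi(\gamma(t))\le(1-t)\psi(\gamma(0))+t\psi(\gamma(1))-\frac\lambda2(1-t)t\,d^2(\gamma(0),\gamma(1))$ for all $t\in[0,1]$. Assume one of the following. * **Case I.** $X$ is a $\mathrm{CAT}(1)$-space, that is, any two points are joined by a minimal geodesic, and for all $x,y,z\in X$ with $d(x,y)+d(y,z)+d(z,x)<2\pi$ and every minimal geodesic $\gamma$ from $y$ to $z$ one has $d(x,\gamma(t))\le d_{\mathbb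 S^2}(\tilde x,\tilde\gamma(t))$ for all $t\in[0,1]$, where $\tilde x\tilde y\tilde z$ is a comparison triangle in the unit sphere $\mathbb S^2$ and $\tilde\gamma$ is the minimal geodesic from $\tilde y$ to $\tilde z$. Moreover, for $i=1,2$, $\varphi_i$ is $\lambda_i$-convex along some minimal geodesic between any two points of $D(\varphi_i)$. * **Case II.** There are a number $K\in\mathbb R$ and a family $\Gamma$ of minimal geodesics, joining any two points of $X$, such that: for every $x\in X$ the function $d^2(x,\cdot)$ is $K$-convex along every $\gamma\in\Gamma$; for all $\gamma,\eta\in\Gamma$ with $\gamma(0)=\eta(0)=x$, $\gamma(1)=y$, $\eta(1)=z$ the commutativity $$\lim_{s\downarrow0}\frac{d^2(\gamma(s),z)-d^2(x,z)}{s}=\lim_{t\downarrow0}\frac{d^2(\eta(t),y)-d^2(x,y)}{t}$$ holds; and, for $i=1,2$, $\varphi_i$ is $\lambda_i$-convex along every $\gamma\in\Gamma$ with endpoints in $D(\varphi_i)$. For $\psi:X\to(-\infty,\infty]$ and $\tau>0$ let $J^\psi_\tau(x)$ be the set of minimizers of $w\mapsto\psi(w)+\frac{d^2(x,w)}{2\tau}$.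 A partition is $\mathscr P_{\boldsymbol\tau}=\{0=t^0_{\boldsymbol\tau}<t^1_{\boldsymbol\tau}<\cdots\}$ with $t^k_{\boldsymbol\tau}\to\infty$; put $\tau_k:=t^k_{\boldsymbol\tau}-t^{k-1}_{\boldsymbol\tau}$ and $|\boldsymbol\tau|:=\sup_k\tau_k\in(0,\infty]$. To a sequence $(x^k)_{k\ge0}$ associate the interpolated curve $\bar x(0):=x^0$, $\bar x(t):=x^k$ for $t\in(t^{k-1}_{\boldsymbol\tau},t^k_{\boldsymbol\tau}]$. A discrete solution for $\psi$ from $x_0$ satisfies $x^0=x_0$ and $x^k\in J^\psi_{\tau_k}(x^{k-1})$ for $k\ge1$. A gradient curve of $\psi$ starting from $x_0\in D(\psi)$ is a curve $\xi:[0,\infty)\to X$ which is the pointwise limit of the interpolated curves of discrete solutions from $x_0$ along some sequence of partitions with $|\boldsymbol\tau_i|\to0$. Let $z_0\in D(\varphi)=D(\varphi_1)\cap D(\varphi_2)$ and consider the solutions of the alternating scheme $$z^0_{\boldsymbol\tau}=z_0,\qquad \hat z^k_{\boldsymbol\tau}\in J^{\varphi_1}_{\tau_k}(z^{k-1}_{\boldsymbol\tau}),\qquad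 z^k_{\boldsymbol\tau}\in J^{\varphi_2}_{\tau_k}(\hat z^k_{\boldsymbol\tau})\qquad(k\ge1).$$ Put $\delta^k_{\boldsymbol\tau}:=\max\{0,\ \varphi_2(\hat z^k_{\boldsymbol\tau})-\varphi_2(z^{k-1}_{\boldsymbol\tau}),\ \varphi_1(z^k_{\boldsymbol\tau})-\varphi_1(\hat z^k_{\boldsymbol\tau})\}$ and assume that for all $\varepsilon,T>0$ there is $\Delta^T_\varepsilon<\infty$ with $\sum_{k=1}^N\delta^k_{\boldsymbol\tau}\le\Delta^T_\varepsilon$ for all partitions with $|\boldsymbol\tau|<\varepsilon$, all $N$ with $t^N_{\boldsymbol\tau}\le T$ and all solutions of the alternating scheme. Then the alternating scheme is solvable for every partition, there is exactly one gradient curve $\xi$ of $\varphi$ starting from $z_0$, and the interpolated curves $\bar z_{\boldsymbol\tau}$ converge to $\xi$ as $|\boldsymbol\tau|\to0$, uniformly on bounded intervals: for all $T,\rho>0$ there is $\eta>0$ such that $d(\bar z_{\boldsymbol\tau}(t),\xi(t))<\rho$ for all $t\in[0,T]$, for every partition with $|\boldsymbol\tau|<\eta$ and every solution of the alternating scheme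 from $z_0$. -/

import Mathlib

open Set Filter Topology

noncomputable section

namespace TrotterKato

/-! ### Geodesics and CAT(1)-spaces -/

/-- `γ`, restricted to `[0,1]`, is a minimal geodesic. Values outside `[0,1]` are irrelevant. -/
def IsMinGeodesic {X : Type*} [MetricSpace X] (γ : ℝ → X) : Prop :=
  ∀ s ∈ Icc (0 : ℝ) 1, ∀ t ∈ Icc (0 : ℝ) 1, dist (γ s) (γ t) = |s - t| * dist (γ 0) (γ 1)

/-- Any two points are joined by a minimal geodesic. -/
def IsGeodesicSpace (X : Type*) [MetricSpace X] : Prop :=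
  ∀ x y : X, ∃ γ : ℝ → X, IsMinGeodesic γ ∧ γ 0 = x ∧ γ 1 = y

/-- The unit sphere `𝕊²` in Euclidean `ℝ³`. -/
abbrev S2 : Type := Metric.sphere (0 : EuclideanSpace ℝ (Fin 3)) 1

/-- The intrinsic (angular) distance of `𝕊²`. -/
def sphDist (p q : S2) : ℝ :=
  InnerProductGeometry.angle (p : EuclideanSpace ℝ (Fin 3)) (q : EuclideanSpace ℝ (Fin 3))

/-- Minimal geodesics of `𝕊²` for the angular distance. -/
def IsSphMinGeodesic (c : ℝ → S2) : Prop :=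
  ∀ s ∈ Icc (0 : ℝ) 1, ∀ t ∈ Icc (0 : ℝ) 1, sphDist (c s) (c t) = |s - t| * sphDist (c 0) (c 1)

/-- `CAT(1)`-spaces: a geodesic space in which, for every triple of points of perimeter `< 2π` and
every minimal geodesic `γ` between the last two of them, distances from the first point to `γ` are
at most those in the comparison triangle in `𝕊²`. The comparison triangle, which always exists and
is unique up to isometries of `𝕊²`, has the vertices `x'`, `c 0`, `c 1`. -/
def IsCAT1 (X : Type*) [MetricSpace X] : Prop :=
  IsGeodesicSpace X ∧
    ∀ (x y z : X), dist x y + dist y z + dist z x < 2 * Real.pi →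
      ∀ γ : ℝ → X, IsMinGeodesic γ → γ 0 = y → γ 1 = z →
        ∃ (x' : S2) (c : ℝ → S2), IsSphMinGeodesic c ∧
          sphDist x' (c 0) = dist x y ∧ sphDist (c 0) (c 1) = dist y z ∧
          sphDist (c 1) x' = dist z x ∧
          ∀ t ∈ Icc (0 : ℝ) 1, dist x (γ t) ≤ sphDist x' (c t)

/-! ### Extended-valued functions and semi-convexity -/

/-- The effective domain `D(φ) = {φ < ∞}` (for functions `φ` with values in `(-∞, ∞]`). -/
def effDomain {X : Type*} (φ : X → EReal) : Set X := {x | φ x ≠ ⊤}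

/-- The `l`-convexity inequality of `φ` along the curve `γ` on `[0,1]`; it is only used when `φ` is
finite at the end points. -/
def ConvexAlong {X : Type*} [MetricSpace X] (l : ℝ) (φ : X → EReal) (γ : ℝ → X) : Prop :=
  ∀ t ∈ Icc (0 : ℝ) 1,
    φ (γ t) ≤ (((1 - t) * (φ (γ 0)).toReal + t * (φ (γ 1)).toReal
      - l / 2 * ((1 - t) * t) * dist (γ 0) (γ 1) ^ 2 : ℝ) : EReal)

/-- `φ` is `l`-convex: the inequality holds along some minimal geodesic between any two points of
the effective domain. -/
def IsLConvex {X : Type*} [MetricSpace X] (l : ℝ) (φ : X → EReal) : Prop :=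
  ∀ x ∈ effDomain φ, ∀ y ∈ effDomain φ,
    ∃ γ : ℝ → X, IsMinGeodesic γ ∧ γ 0 = x ∧ γ 1 = y ∧ ConvexAlong l φ γ

/-- `Γ` is a family of minimal geodesics which joins any two points. -/
def IsGeodesicFamily {X : Type*} [MetricSpace X] (Γ : Set (ℝ → X)) : Prop :=
  (∀ γ ∈ Γ, IsMinGeodesic γ) ∧ ∀ x y : X, ∃ γ ∈ Γ, γ 0 = x ∧ γ 1 = y

/-- `φ` is `l`-convex along the geodesics of the family `Γ` with end points in `D(φ)`. -/
def IsLConvexAlong {X : Type*} [MetricSpace X] (Γ : Set (ℝ → X)) (l : ℝ) (φ : X → EReal) : Prop :=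
  ∀ γ ∈ Γ, γ 0 ∈ effDomain φ → γ 1 ∈ effDomain φ → ConvexAlong l φ γ

/-- `K`-convexity of all functions `d²(x, ·)` along the family `Γ`. -/
def SqDistConvexAlong {X : Type*} [MetricSpace X] (Γ : Set (ℝ → X)) (K : ℝ) : Prop :=
  ∀ x : X, IsLConvexAlong Γ K (fun z => ((dist x z ^ 2 : ℝ) : EReal))

/-- Commutativity of the family `Γ`: for two geodesics `γ`, `η` of `Γ` issuing from the same point,
the one-sided derivative at `0` of `d²(γ(s), η(1))` equals that of `d²(η(t), γ(1))`. -/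
def IsCommutative {X : Type*} [MetricSpace X] (Γ : Set (ℝ → X)) : Prop :=
  ∀ γ ∈ Γ, ∀ η ∈ Γ, γ 0 = η 0 →
    ∃ L : ℝ,
      Tendsto (fun s : ℝ => (dist (γ s) (η 1) ^ 2 - dist (γ 0) (η 1) ^ 2) / s) (𝓝[>] 0) (𝓝 L) ∧
      Tendsto (fun t : ℝ => (dist (η t) (γ 1) ^ 2 - dist (η 0) (γ 1) ^ 2) / t) (𝓝[>] 0) (𝓝 L)

/-- Bounded subsets of sub-level sets of `φ` are relatively compact. -/
def SublevelsCompact {X : Type*} [MetricSpace X] (φ : X → EReal) : Prop :=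
  ∀ (Q : ℝ) (S : Set X), S ⊆ {x | φ x ≤ (Q : EReal)} → Bornology.IsBounded S →
    IsCompact (closure S)

/-! ### Variational schemes -/

/-- The Moreau-Yosida approximation `φ_τ`. -/
def moreauYosida {X : Type*} [MetricSpace X] (φ : X → EReal) (τ : ℝ) (x : X) : EReal :=
  ⨅ z : X, φ z + ((dist x z ^ 2 / (2 * τ) : ℝ) : EReal)

/-- The set `J_τ^φ(x)` of points attaining the infimum `φ_τ(x)`. -/
def proxSet {X : Type*} [MetricSpace X] (φ : X → EReal) (τ : ℝ) (x : X) : Set X :=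
  {z | φ z + ((dist x z ^ 2 / (2 * τ) : ℝ) : EReal) = moreauYosida φ τ x}

/-- Partitions `0 = t⁰ < t¹ < ⋯ → ∞` of `[0, ∞)`. -/
structure TimePartition where
  t : ℕ → ℝ
  t_zero : t 0 = 0
  strictMono : StrictMono t
  tendsto : Tendsto t atTop atTop

/-- The length of the step that follows `tᵏ`, that is `τ_{k+1} = tᵏ⁺¹ - tᵏ`. -/
def TimePartition.step (P : TimePartition) (k : ℕ) : ℝ := P.t (k + 1) - P.t k

/-- The mesh `|τ|`, the supremum of the step lengths; it may be infinite. -/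
def TimePartition.mesh (P : TimePartition) : EReal := ⨆ k : ℕ, ((P.step k : ℝ) : EReal)

/-- The piecewise constant interpolation of `(x k)`: the value at `t` is `x k` for the least `k`
with `t ≤ tᵏ`. -/
def interp {X : Type*} (P : TimePartition) (x : ℕ → X) (t : ℝ) : X :=
  x (sInf {k : ℕ | t ≤ P.t k})

theorem interp_zero {X : Type*} (P : TimePartition) (x : ℕ → X) : interp P x 0 = x 0 := by
  have h : sInf {k : ℕ | (0 : ℝ) ≤ P.t k} = 0 :=
    Nat.sInf_eq_zero.2 (Or.inl (by simp [P.t_zero]))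
  simp [interp, h]

theorem interp_of_mem {X : Type*} (P : TimePartition) (x : ℕ → X) (k : ℕ) (t : ℝ)
    (ht : t ∈ Ioc (P.t k) (P.t (k + 1))) : interp P x t = x (k + 1) := by
  have h : sInf {j : ℕ | t ≤ P.t j} = k + 1 := by
    apply le_antisymm
    · exact Nat.sInf_le ht.2
    · refine le_csInf ⟨k + 1, ht.2⟩ fun j hj => ?_
      have h1 : P.t k < P.t j := lt_of_lt_of_le ht.1 hj
      exact P.strictMono.lt_iff_lt.1 h1
  simp [interp, h]

/-- Discrete solutions of the variational scheme for `φ` starting from `x₀`. -/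
def IsDiscreteSolution {X : Type*} [MetricSpace X] (φ : X → EReal) (P : TimePartition) (x₀ : X)
    (x : ℕ → X) : Prop :=
  x 0 = x₀ ∧ ∀ k : ℕ, x (k + 1) ∈ proxSet φ (P.step k) (x k)

/-- `ξ` (on `[0, ∞)`) is a gradient curve of `φ` starting from `x₀`: it is the pointwise limit of
the interpolations of discrete solutions starting from `x₀`, along some sequence of partitions
whose meshes tend to `0`. -/
def IsGradientCurve {X : Type*} [MetricSpace X] (φ : X → EReal) (x₀ : X) (ξ : ℝ → X) : Prop :=
  ∃ (P : ℕ → TimePartition) (x : ℕ → ℕ → X),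
    (∀ i, IsDiscreteSolution φ (P i) x₀ (x i)) ∧
    Tendsto (fun i => (P i).mesh) atTop (𝓝 0) ∧
    ∀ t : ℝ, 0 ≤ t → Tendsto (fun i => interp (P i) (x i) t) atTop (𝓝 (ξ t))

/-- Solutions of the alternating scheme: a `φ₁`-step from `z k` to `zh (k+1)` followed by a
`φ₂`-step from `zh (k+1)` to `z (k+1)`. The value `zh 0` is not used. -/
def IsSplitSolution {X : Type*} [MetricSpace X] (φ₁ φ₂ : X → EReal) (P : TimePartition) (z₀ : X)
    (zh z : ℕ → X) : Prop :=
  z 0 = z₀ ∧ ∀ k : ℕ, zh (k + 1) ∈ proxSet φ₁ (P.step k) (z k) ∧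
    z (k + 1) ∈ proxSet φ₂ (P.step k) (zh (k + 1))

/-- The increment `δ^{k+1}`, with values in `[0, ∞]`. -/
def increment {X : Type*} (φ₁ φ₂ : X → EReal) (zh z : ℕ → X) (k : ℕ) : EReal :=
  max 0 (max (φ₂ (zh (k + 1)) - φ₂ (z k)) (φ₁ (z (k + 1)) - φ₁ (zh (k + 1))))

/-- For all `ε, T > 0` the sums `δ¹ + ⋯ + δᴺ` with `tᴺ ≤ T` are bounded, uniformly over all
partitions of mesh `< ε` and all solutions of the alternating scheme starting from `z₀`. -/
def IncrementsSummable {X : Type*} [MetricSpace X] (φ₁ φ₂ : X → EReal) (z₀ : X) : Prop :=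
  ∀ ε : ℝ, 0 < ε → ∀ T : ℝ, 0 < T → ∃ Δ : ℝ,
    ∀ P : TimePartition, P.mesh < (ε : EReal) → ∀ N : ℕ, P.t N ≤ T →
      ∀ zh z : ℕ → X, IsSplitSolution φ₁ φ₂ P z₀ zh z →
        ∑ k ∈ Finset.range N, increment φ₁ φ₂ zh z k ≤ (Δ : EReal)

end TrotterKato

end

/-!
In both settings the squared distance satisfies a first variation inequality along short geodesics:
in a `CAT(1)`-space by comparison with the spherical law of cosines, in the commutative setting by
convexity of one of the two squared distances. Together with the convexity of the potential it turns
the minimality of a proximal point into a discrete evolution variational inequality (EVI), which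
however only holds against points at distance at most `r`.

Composing two such steps yields an EVI for `φ₁ + φ₂` along the alternating scheme, with an error
controlled by the dissipated energy plus the increments `δᵏ`. Discrete solutions for `φ₁ + φ₂` are
solutions of the alternating scheme for the pair `(φ₁ + φ₂, 0)`, for which `δᵏ = 0`.

Two sequences with EVIs on different partitions are compared by doubling the variables, as in the
Crandall-Liggett theorem: `d²(z j, w k)` is dominated by a supersolution of the recursion obtained
by adding the EVI of `z` at `w` to that of `w` at `z`. Since both sequences are Hölder continuous
in time, `z j` and `w k` are closer than `r` whenever `|t j - s k|` is small, and away from the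
diagonal the supersolution dominates `d²(z j, w k)` anyway. Hence all interpolations are uniformly
close to each other on fine partitions.
-/

namespace TrotterKato

/-! ### Comparison with the unit sphere -/

section Sphere

theorem sin_add_smul_eq_of_inner_eq_cos {E : Type*} [NormedAddCommGroup E] [InnerProductSpace ℝ E]
    {u v w : E} (hu : ‖u‖ = 1) (hv : ‖v‖ = 1) (hw : ‖w‖ = 1) {α β : ℝ}
    (huw : inner ℝ u w = Real.cos α) (hwv : inner ℝ w v = Real.cos β)
    (huv : inner ℝ u v = Real.cos (α + β)) :
    Real.sin (α + β) • w = Real.sin β • u + Real.sin α • v := by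
  have hself : ∀ {p : E}, ‖p‖ = 1 → inner ℝ p p = 1 := fun hp => by
    rw [real_inner_self_eq_norm_sq, hp, one_pow]
  rw [← sub_eq_zero, ← inner_self_eq_zero (𝕜 := ℝ)]
  simp only [inner_sub_left, inner_sub_right, inner_add_left, inner_add_right,
    real_inner_smul_left, real_inner_smul_right, hself hu, hself hv, hself hw,
    real_inner_comm u w, real_inner_comm w v, real_inner_comm u v, huw, hwv, huv,
    Real.sin_add, Real.cos_add]
  have hα := Real.sin_sq_add_cos_sq α
  have hβ := Real.sin_sq_add_cos_sq β
  linear_combination (-Real.sin α ^ 2) * hβ - Real.sin β ^ 2 * hα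

theorem norm_coe_S2 (p : S2) : ‖(p : EuclideanSpace ℝ (Fin 3))‖ = 1 := by simp

theorem cos_sphDist (p q : S2) :
    Real.cos (sphDist p q) =
      inner ℝ (p : EuclideanSpace ℝ (Fin 3)) (q : EuclideanSpace ℝ (Fin 3)) := by
  rw [sphDist, InnerProductGeometry.cos_angle, norm_coe_S2, norm_coe_S2, mul_one, div_one]

theorem IsSphMinGeodesic.sin_mul_cos_sphDist {c : ℝ → S2} (hc : IsSphMinGeodesic c) (x : S2)
    {t : ℝ} (ht : t ∈ Icc (0 : ℝ) 1) :
    Real.sin (sphDist (c 0) (c 1)) * Real.cos (sphDist x (c t)) =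
      Real.sin ((1 - t) * sphDist (c 0) (c 1)) * Real.cos (sphDist x (c 0)) +
        Real.sin (t * sphDist (c 0) (c 1)) * Real.cos (sphDist x (c 1)) := by
  have h0 := hc 0 (left_mem_Icc.2 zero_le_one) t ht
  have h1 := hc t ht 1 (right_mem_Icc.2 zero_le_one)
  rw [zero_sub, abs_neg, abs_of_nonneg ht.1] at h0
  rw [abs_sub_comm, abs_of_nonneg (sub_nonneg.2 ht.2)] at h1
  have hsum : t * sphDist (c 0) (c 1) + (1 - t) * sphDist (c 0) (c 1) = sphDist (c 0) (c 1) := by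
    ring
  have hvec := sin_add_smul_eq_of_inner_eq_cos (norm_coe_S2 (c 0)) (norm_coe_S2 (c 1))
    (norm_coe_S2 (c t)) (by rw [← cos_sphDist, h0]) (by rw [← cos_sphDist, h1])
    (by rw [← cos_sphDist, hsum])
  have hinner := congrArg (inner ℝ (x : EuclideanSpace ℝ (Fin 3))) hvec
  simpa only [inner_add_right, real_inner_smul_right, ← cos_sphDist, hsum] using hinner

end Sphere

section CAT1

variable {X : Type*} [MetricSpace X] {γ η : ℝ → X} {t : ℝ}

theorem IsMinGeodesic.dist_zero (hγ : IsMinGeodesic γ) (ht : t ∈ Icc (0 : ℝ) 1) :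
    dist (γ t) (γ 0) = t * dist (γ 0) (γ 1) := by
  have h := hγ t ht 0 (left_mem_Icc.2 zero_le_one)
  rwa [sub_zero, abs_of_nonneg ht.1] at h

theorem IsMinGeodesic.dist_one (hγ : IsMinGeodesic γ) (ht : t ∈ Icc (0 : ℝ) 1) :
    dist (γ t) (γ 1) = (1 - t) * dist (γ 0) (γ 1) := by
  have h := hγ t ht 1 (right_mem_Icc.2 zero_le_one)
  rwa [abs_sub_comm, abs_of_nonneg (sub_nonneg.2 ht.2)] at h

theorem IsCAT1.le_sin_mul_cos_dist (hX : IsCAT1 X) {x : X} (hγ : IsMinGeodesic γ)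
    (hp : dist x (γ 0) + dist (γ 0) (γ 1) + dist (γ 1) x < 2 * Real.pi)
    (ht : t ∈ Icc (0 : ℝ) 1) :
    Real.sin ((1 - t) * dist (γ 0) (γ 1)) * Real.cos (dist x (γ 0)) +
        Real.sin (t * dist (γ 0) (γ 1)) * Real.cos (dist x (γ 1)) ≤
      Real.sin (dist (γ 0) (γ 1)) * Real.cos (dist x (γ t)) := by
  obtain ⟨x', c, hc, h0, h01, h1, hle⟩ := hX.2 x _ _ hp γ hγ rfl rfl
  have hb : dist (γ 0) (γ 1) ≤ Real.pi := by
    linarith [dist_triangle_left (γ 0) (γ 1) x, dist_comm x (γ 1)]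
  have h1' : sphDist x' (c 1) = dist x (γ 1) := by
    rw [dist_comm, ← h1]; exact InnerProductGeometry.angle_comm _ _
  have hcomparison := hc.sin_mul_cos_sphDist x' ht
  rw [h01, h0, h1'] at hcomparison
  rw [← hcomparison]
  exact mul_le_mul_of_nonneg_left (Real.cos_le_cos_of_nonneg_of_le_pi dist_nonneg
    (InnerProductGeometry.angle_le_pi _ _) (hle t ht)) (Real.sin_nonneg_of_nonneg_of_le_pi
      dist_nonneg hb)

theorem IsCAT1.eqOn_of_dist_lt_pi (hX : IsCAT1 X) (hγ : IsMinGeodesic γ) (hη : IsMinGeodesic η)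
    (h0 : η 0 = γ 0) (h1 : η 1 = γ 1) (hb : dist (γ 0) (γ 1) < Real.pi) :
    EqOn η γ (Icc 0 1) := by
  intro t ht
  have hη0 := hη.dist_zero ht
  have hη1 := hη.dist_one ht
  rw [h0, h1] at hη0 hη1
  have hd : dist (η t) (γ t) ≤ 2 * (t * dist (γ 0) (γ 1)) := by
    linarith [dist_triangle_right (η t) (γ t) (γ 0), hγ.dist_zero ht]
  have hcmp := hX.le_sin_mul_cos_dist (x := η t) hγ
    (by rw [dist_comm (γ 1), hη0, hη1]; linarith) ht
  rw [hη0, hη1, mul_comm (Real.sin (t * _)), ← Real.sin_add, ← add_mul, sub_add_cancel, one_mul]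
    at hcmp
  rcases (dist_nonneg (x := γ 0) (y := γ 1)).eq_or_lt with hzero | hpos
  · rw [← hzero, mul_zero, mul_zero] at hd
    exact dist_le_zero.1 hd
  have hcos : Real.cos (dist (η t) (γ t)) = 1 :=
    (Real.cos_le_one _).antisymm
      (le_of_mul_le_mul_left (by rwa [mul_one]) (Real.sin_pos_of_pos_of_lt_pi hpos hb))
  have hlt : dist (η t) (γ t) < 2 * Real.pi := by nlinarith [ht.2]
  exact dist_eq_zero.1 ((Real.cos_eq_one_iff_of_lt_of_lt
    (by linarith [dist_nonneg (x := η t) (y := γ t), Real.pi_pos]) hlt).1 hcos)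

end CAT1

section Trigonometry

variable {a b c : ℝ}

theorem cos_tangent_le (p : ℝ) {q : ℝ} (hpq : |q - p| ≤ 1) :
    Real.cos p - Real.sin p * (q - p) - 2 / 3 * (q - p) ^ 2 ≤ Real.cos q := by
  have hcos : |Real.cos (q - p) - 1| ≤ (q - p) ^ 2 / 2 := by
    rw [abs_le]
    constructor <;> nlinarith [Real.one_sub_sq_div_two_le_cos (x := q - p),
      Real.cos_le_one (q - p)]
  have hsin : |q - p - Real.sin (q - p)| ≤ (q - p) ^ 2 / 6 := by
    refine (Real.abs_sub_sin_le _).trans ?_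
    rw [← sq_abs (q - p)]
    nlinarith [sq_nonneg |q - p|]
  have hremainder : Real.cos q - Real.cos p + Real.sin p * (q - p) =
      Real.cos p * (Real.cos (q - p) - 1) + Real.sin p * (q - p - Real.sin (q - p)) := by
    rw [show Real.cos q = Real.cos (p + (q - p)) by ring_nf, Real.cos_add]; ring
  have h1 : |Real.cos p * (Real.cos (q - p) - 1)| ≤ (q - p) ^ 2 / 2 := by
    rw [abs_mul]
    exact (mul_le_of_le_one_left (abs_nonneg _) (Real.abs_cos_le_one p)).trans hcos
  have h2 : |Real.sin p * (q - p - Real.sin (q - p))| ≤ (q - p) ^ 2 / 6 := by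
    rw [abs_mul]
    exact (mul_le_of_le_one_left (abs_nonneg _) (Real.abs_sin_le_one p)).trans hsin
  linarith [(abs_le.1 h1).1, (abs_le.1 h2).1]

theorem one_le_div_sin (ha : 0 < a) (ha1 : a ≤ 1) : 1 ≤ a / Real.sin a :=
  (one_le_div (Real.sin_pos_of_pos_of_le_one ha ha1)).2 (Real.sin_le ha.le)

theorem div_sin_le (ha : 0 < a) (ha1 : a ≤ 1) : a / Real.sin a ≤ 1 + a ^ 2 / 3 := by
  rw [div_le_iff₀ (Real.sin_pos_of_pos_of_le_one ha ha1)]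
  have hsq : a ^ 2 ≤ 1 := pow_le_one₀ ha.le ha1
  calc a ≤ (1 + a ^ 2 / 3) * (a - a ^ 3 / 6) := by nlinarith [pow_pos ha 3]
    _ ≤ (1 + a ^ 2 / 3) * Real.sin a := by gcongr; exact (Real.sin_gt_sub_cube ha).le

theorem spherical_law_of_cosines_estimate (ha : 0 < a) (ha1 : a ≤ 1) (hb : 0 < b) (hb1 : b ≤ 1)
    (hc : |c - b| ≤ a) :
    -(2 * (a / Real.sin a) * (b / Real.sin b)) * (Real.cos c - Real.cos a * Real.cos b) ≤
      c ^ 2 - b ^ 2 + 3 * a ^ 2 := by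
  have hsq : (c - b) ^ 2 ≤ a ^ 2 := sq_le_sq' (abs_le.1 hc).1 (abs_le.1 hc).2
  have hBsin : b / Real.sin b * Real.sin b = b :=
    div_mul_cancel₀ _ (Real.sin_pos_of_pos_of_le_one hb hb1).ne'
  have hB2 : b / Real.sin b ≤ 4 / 3 := by
    linarith [div_sin_le hb hb1, pow_le_one₀ hb.le hb1 (n := 2)]
  have hA1 := one_le_div_sin ha ha1
  have hA2 := div_sin_le ha ha1
  have hB1 := one_le_div_sin hb hb1
  generalize a / Real.sin a = A at *
  generalize b / Real.sin b = B at *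
  have hmain : -(2 * B) * (Real.cos c - Real.cos b) ≤ c ^ 2 - b ^ 2 + 7 / 9 * a ^ 2 := by
    have htangent := mul_le_mul_of_nonneg_left (cos_tangent_le b (hc.trans ha1))
      (by linarith : 0 ≤ 2 * B)
    have hsin : 2 * B * (Real.sin b * (c - b)) = 2 * b * (c - b) := by
      linear_combination 2 * (c - b) * hBsin
    linarith [mul_le_mul_of_nonneg_right hB2 (sq_nonneg (c - b))]
  have hcurvature : -(2 * B * (A - 1)) * (Real.cos c - Real.cos b) ≤ 16 / 9 * a ^ 2 := by
    have hcos : -2 ≤ Real.cos c - Real.cos b := by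
      linarith [Real.neg_one_le_cos c, Real.cos_le_one b]
    have hAB : B * (A - 1) ≤ 4 / 3 * (a ^ 2 / 3) := by gcongr; linarith
    nlinarith [mul_nonneg (by linarith : 0 ≤ B) (by linarith : 0 ≤ A - 1)]
  have hdefect : 0 ≤ 2 * A * B * (Real.cos b * (1 - Real.cos a)) :=
    mul_nonneg (by nlinarith) (mul_nonneg (Real.cos_nonneg_of_mem_Icc
      ⟨by linarith [Real.pi_pos], by linarith [Real.pi_gt_three]⟩)
      (sub_nonneg.2 (Real.cos_le_one a)))
  linarith [sq_nonneg a]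

end Trigonometry

/-! ### First variation of the squared distance -/

section FirstVariation

/-- The upper right Dini derivative of `u` at `0` is at most `B`. -/
def UpperRightDerivLE (u : ℝ → ℝ) (B : ℝ) : Prop :=
  ∀ D, B < D → ∀ᶠ t in 𝓝[>] (0 : ℝ), (u t - u 0) / t < D

theorem UpperRightDerivLE.of_tendsto {u : ℝ → ℝ} {L B : ℝ}
    (hu : Tendsto (fun t => (u t - u 0) / t) (𝓝[>] 0) (𝓝 L)) (hLB : L ≤ B) :
    UpperRightDerivLE u B :=
  fun _ hD => hu.eventually_lt_const (hLB.trans_lt hD)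

theorem UpperRightDerivLE.of_hasDerivAt_of_le {u F : ℝ → ℝ} {F' B : ℝ} (hF : HasDerivAt F F' 0)
    (h0 : F 0 = u 0) (hle : ∀ᶠ t in 𝓝[>] (0 : ℝ), u t ≤ F t) (hB : F' ≤ B) :
    UpperRightDerivLE u B := by
  intro D hD
  have hslope := hF.tendsto_slope_zero_right.eventually_lt_const (hB.trans_lt hD)
  filter_upwards [hslope, hle, self_mem_nhdsWithin] with t ht hut htpos
  refine lt_of_le_of_lt ?_ ht
  rw [zero_add, smul_eq_mul, h0, div_eq_inv_mul]
  exact mul_le_mul_of_nonneg_left (sub_le_sub_right hut _) (inv_nonneg.2 (le_of_lt htpos))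

/-- A family of curves joining all points at distance at most `r`, for which the squared distance
satisfies a first variation inequality at distances at most `r`. In a Euclidean space the upper
right derivative of `t ↦ d²(x, γ t)` at `0` is `d²(x, γ 1) - d²(γ 0, γ 1) - d²(x, γ 0)`. -/
structure IsVariationFamily {X : Type*} [MetricSpace X] (r C : ℝ) (Γ : Set (ℝ → X)) : Prop where
  joins : ∀ x y : X, dist x y ≤ r → ∃ γ ∈ Γ, γ 0 = x ∧ γ 1 = y
  firstVariation : ∀ γ ∈ Γ, ∀ x : X, dist x (γ 0) ≤ r → dist (γ 0) (γ 1) ≤ r →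
    UpperRightDerivLE (fun t => dist x (γ t) ^ 2)
      (dist x (γ 1) ^ 2 - dist (γ 0) (γ 1) ^ 2 + C * dist x (γ 0) ^ 2)

theorem hasDerivAt_arccos_sq_spherical {a b c : ℝ} (ha : 0 < a) (haπ : a < Real.pi)
    (hb : 0 < b) (hbπ : b < Real.pi) :
    HasDerivAt
      (fun t => Real.arccos ((Real.sin ((1 - t) * b) * Real.cos a + Real.sin (t * b) * Real.cos c) /
        Real.sin b) ^ 2)
      (-(2 * (a / Real.sin a) * (b / Real.sin b)) * (Real.cos c - Real.cos a * Real.cos b)) 0 := by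
  have hsa := Real.sin_pos_of_pos_of_lt_pi ha haπ
  have hsb := Real.sin_pos_of_pos_of_lt_pi hb hbπ
  set f : ℝ → ℝ := fun t =>
    (Real.sin ((1 - t) * b) * Real.cos a + Real.sin (t * b) * Real.cos c) / Real.sin b with hf
  have hf0 : f 0 = Real.cos a := by simp [hf, hsb.ne']
  have hf' : HasDerivAt f (b * (Real.cos c - Real.cos a * Real.cos b) / Real.sin b) 0 := by
    have h1 : HasDerivAt (fun t : ℝ => (1 - t) * b) (-b) 0 := by
      simpa using ((hasDerivAt_id (0 : ℝ)).const_sub 1).mul_const b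
    have h2 : HasDerivAt (fun t : ℝ => t * b) b 0 := by
      simpa using (hasDerivAt_id (0 : ℝ)).mul_const b
    refine (((h1.sin.mul_const (Real.cos a)).add (h2.sin.mul_const (Real.cos c))).div_const
      (Real.sin b)).congr_deriv ?_
    rw [sub_zero, one_mul, zero_mul, Real.cos_zero]
    ring
  have hroot : √(1 - f 0 ^ 2) = Real.sin a := by
    rw [hf0, ← Real.abs_sin_eq_sqrt_one_sub_cos_sq, abs_of_pos hsa]
  have hne : Real.cos a ^ 2 ≠ 1 := fun h =>
    (pow_pos hsa 2).ne' (by linarith [Real.sin_sq_add_cos_sq a])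
  have harccos := (Real.hasDerivAt_arccos (x := f 0)
    (fun h => hne (by rw [← hf0, h]; norm_num)) (fun h => hne (by rw [← hf0, h, one_pow]))).comp
    (0 : ℝ) hf'
  refine (harccos.pow 2).congr_deriv ?_
  rw [hroot, Function.comp_apply, hf0, Real.arccos_cos ha.le haπ.le]
  field_simp
  norm_num
  ring

variable {X : Type*} [MetricSpace X]

theorem IsCAT1.upperRightDerivLE_sq_dist (hX : IsCAT1 X) {γ : ℝ → X} (hγ : IsMinGeodesic γ) {x : X}
    (ha1 : dist x (γ 0) ≤ 1) (hb1 : dist (γ 0) (γ 1) ≤ 1) :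
    UpperRightDerivLE (fun t => dist x (γ t) ^ 2)
      (dist x (γ 1) ^ 2 - dist (γ 0) (γ 1) ^ 2 + 3 * dist x (γ 0) ^ 2) := by
  have hunit : ∀ᶠ t in 𝓝[>] (0 : ℝ), t ∈ Icc (0 : ℝ) 1 := Icc_mem_nhdsGT zero_lt_one
  rcases (dist_nonneg (x := x) (y := γ 0)).eq_or_lt with ha | ha
  · obtain rfl := dist_eq_zero.1 ha.symm
    refine .of_hasDerivAt_of_le (F := fun t => (t * dist (γ 0) (γ 1)) ^ 2)
      (((hasDerivAt_id (0 : ℝ)).mul_const _).pow 2) (by simp) ?_ (by simp)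
    filter_upwards [hunit] with t ht
    rw [dist_comm, hγ.dist_zero ht]
  rcases (dist_nonneg (x := γ 0) (y := γ 1)).eq_or_lt with hb | hb
  · refine .of_hasDerivAt_of_le (hasDerivAt_const (0 : ℝ) (dist x (γ 0) ^ 2)) rfl ?_ ?_
    · filter_upwards [hunit] with t ht
      rw [dist_eq_zero.1 ((hγ.dist_zero ht).trans (by rw [← hb, mul_zero]))]
    · rw [← hb, ← dist_eq_zero.1 hb.symm]
      linarith [sq_nonneg (dist x (γ 0))]
  have hπ := Real.pi_gt_three
  have hsb := Real.sin_pos_of_pos_of_le_one hb hb1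
  have hperimeter : dist x (γ 0) + dist (γ 0) (γ 1) + dist (γ 1) x < 2 * Real.pi := by
    linarith [dist_triangle_right (γ 1) x (γ 0), dist_comm (γ 1) (γ 0)]
  refine .of_hasDerivAt_of_le
    (hasDerivAt_arccos_sq_spherical ha (by linarith) hb (by linarith) (c := dist x (γ 1))) ?_ ?_
    (spherical_law_of_cosines_estimate ha ha1 hb hb1 (abs_dist_sub_le x (γ 0) (γ 1)))
  · simp [hsb.ne', Real.arccos_cos ha.le (by linarith)]
  · filter_upwards [hunit] with t ht
    have hdist : dist x (γ t) ≤ Real.pi := by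
      nlinarith [dist_triangle_right x (γ t) (γ 0), hγ.dist_zero ht, ht.2]
    have hcmp := hX.le_sin_mul_cos_dist hγ hperimeter ht
    rw [← Real.arccos_cos dist_nonneg hdist]
    exact pow_le_pow_left₀ (Real.arccos_nonneg _)
      (Real.arccos_le_arccos ((div_le_iff₀' hsb).2 hcmp)) 2

theorem IsCAT1.isVariationFamily (hX : IsCAT1 X) :
    IsVariationFamily 1 3 {γ : ℝ → X | IsMinGeodesic γ ∧ dist (γ 0) (γ 1) < Real.pi} where
  joins x y hxy := by
    obtain ⟨γ, hγ, rfl, rfl⟩ := hX.1 x y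
    exact ⟨γ, ⟨hγ, by linarith [Real.pi_gt_three]⟩, rfl, rfl⟩
  firstVariation _ hγ _ hx hlength := hX.upperRightDerivLE_sq_dist hγ.1 hx hlength

theorem IsCAT1.isLConvexAlong (hX : IsCAT1 X) {l : ℝ} {φ : X → EReal} (hφ : IsLConvex l φ) :
    IsLConvexAlong {γ : ℝ → X | IsMinGeodesic γ ∧ dist (γ 0) (γ 1) < Real.pi} l φ := by
  rintro γ ⟨hγ, hlength⟩ h0 h1 t ht
  obtain ⟨η, hη, hη0, hη1, hconv⟩ := hφ _ h0 _ h1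
  have h := hconv t ht
  rwa [hη0, hη1, hX.eqOn_of_dist_lt_pi hγ hη hη0 hη1 hlength ht] at h

theorem SqDistConvexAlong.sq_dist_quotient_le {Γ : Set (ℝ → X)} {K : ℝ}
    (hK : SqDistConvexAlong Γ K) {η : ℝ → X} (hη : η ∈ Γ) (y : X) {t : ℝ} (ht : t ∈ Ioc (0 : ℝ) 1) :
    (dist (η t) y ^ 2 - dist (η 0) y ^ 2) / t ≤
      dist (η 1) y ^ 2 - dist (η 0) y ^ 2 + |K| / 2 * dist (η 0) (η 1) ^ 2 := by
  have hconv := hK y η hη (EReal.coe_ne_top _) (EReal.coe_ne_top _) t (Ioc_subset_Icc_self ht)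
  simp only [EReal.toReal_coe, EReal.coe_le_coe_iff, dist_comm y] at hconv
  have hdefect : -(K / 2) * (1 - t) ≤ |K| / 2 := by
    nlinarith [neg_abs_le K, abs_nonneg K, ht.1, ht.2]
  rw [div_le_iff₀ ht.1]
  linarith [mul_le_mul_of_nonneg_right hdefect
    (mul_nonneg ht.1.le (sq_nonneg (dist (η 0) (η 1))))]

theorem IsCommutative.isVariationFamily {Γ : Set (ℝ → X)} {K : ℝ} (hcomm : IsCommutative Γ)
    (hΓ : IsGeodesicFamily Γ) (hK : SqDistConvexAlong Γ K) (r : ℝ) :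
    IsVariationFamily r (|K| / 2) Γ where
  joins x y _ := hΓ.2 x y
  firstVariation γ hγ x _ _ := by
    obtain ⟨η, hη, hη0, rfl⟩ := hΓ.2 (γ 0) x
    obtain ⟨L, hγL, hηL⟩ := hcomm γ hγ η hη hη0.symm
    simp only [dist_comm (η 1)]
    refine .of_tendsto hγL (le_of_tendsto hηL ?_)
    filter_upwards [Ioc_mem_nhdsGT (zero_lt_one' ℝ)] with t ht
    have h := hK.sq_dist_quotient_le hη (γ 1) ht
    rw [hη0, dist_comm (η 1)] at h
    rwa [hη0]

theorem exists_isVariationFamily {l₁ l₂ : ℝ} {φ₁ φ₂ : X → EReal}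
    (hcase :
      (IsCAT1 X ∧ IsLConvex l₁ φ₁ ∧ IsLConvex l₂ φ₂) ∨
      (∃ (Γ : Set (ℝ → X)) (K : ℝ), IsGeodesicFamily Γ ∧ IsCommutative Γ ∧
        SqDistConvexAlong Γ K ∧ IsLConvexAlong Γ l₁ φ₁ ∧ IsLConvexAlong Γ l₂ φ₂)) :
    ∃ (C : ℝ) (Γ : Set (ℝ → X)), IsVariationFamily 1 C Γ ∧
      IsLConvexAlong Γ l₁ φ₁ ∧ IsLConvexAlong Γ l₂ φ₂ := by
  rcases hcase with ⟨hX, h₁, h₂⟩ | ⟨Γ, K, hΓ, hcomm, hK, h₁, h₂⟩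
  · exact ⟨3, _, hX.isVariationFamily, hX.isLConvexAlong h₁, hX.isLConvexAlong h₂⟩
  · exact ⟨|K| / 2, Γ, hcomm.isVariationFamily hΓ hK 1, h₁, h₂⟩

end FirstVariation

/-! ### Proximal points -/

section Minimizers

variable {X : Type*}

theorem exists_forall_le_of_isCompact_sublevel [TopologicalSpace X] {β : Type*} [LinearOrder β]
    {f : X → β} (hf : LowerSemicontinuous f) {y : X} (hc : IsCompact {x | f x ≤ f y}) :
    ∃ w, ∀ v, f w ≤ f v := by
  obtain ⟨w, hw, hmin⟩ := (hf.lowerSemicontinuousOn _).exists_isMinOn ⟨y, le_refl (f y)⟩ hc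
  refine ⟨w, fun v => ?_⟩
  rcases le_total (f v) (f y) with hv | hv
  · exact hmin hv
  · exact le_trans hw hv

theorem ne_bot_of_coe_le {φ : X → EReal} {b : ℝ} (hb : ∀ x, (b : EReal) ≤ φ x) (x : X) :
    φ x ≠ ⊥ :=
  ne_bot_of_le_ne_bot (EReal.coe_ne_bot b) (hb x)

variable {φ₁ φ₂ : X → EReal}

theorem add_ne_bot (h₁ : ∀ x, φ₁ x ≠ ⊥) (h₂ : ∀ x, φ₂ x ≠ ⊥) (x : X) : φ₁ x + φ₂ x ≠ ⊥ := by
  simp [EReal.add_eq_bot_iff, h₁, h₂]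

theorem ne_top_of_add_ne_top (h₁ : ∀ x, φ₁ x ≠ ⊥) (h₂ : ∀ x, φ₂ x ≠ ⊥) {x : X}
    (hx : φ₁ x + φ₂ x ≠ ⊤) : φ₁ x ≠ ⊤ ∧ φ₂ x ≠ ⊤ :=
  ⟨fun h => hx (by rw [h, EReal.top_add_of_ne_bot (h₂ x)]),
    fun h => hx (by rw [h, EReal.add_top_of_ne_bot (h₁ x)])⟩

theorem lowerSemicontinuous_add [TopologicalSpace X] (h₁ : ∀ x, φ₁ x ≠ ⊥) (h₂ : ∀ x, φ₂ x ≠ ⊥)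
    (hl₁ : LowerSemicontinuous φ₁) (hl₂ : LowerSemicontinuous φ₂) :
    LowerSemicontinuous (fun x => φ₁ x + φ₂ x) :=
  hl₁.add' hl₂ fun x => EReal.continuousAt_add (Or.inr (h₂ x)) (Or.inl (h₁ x))

variable [MetricSpace X]

theorem SublevelsCompact.isCompact_sublevel {φ : X → EReal} (hcpt : SublevelsCompact φ)
    {f : X → EReal} (hf : LowerSemicontinuous f) (hφf : ∀ x, φ x ≤ f x) {Q : EReal} (hQ : Q ≠ ⊤)
    (hbdd : Bornology.IsBounded {x | f x ≤ Q}) : IsCompact {x | f x ≤ Q} := by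
  have hclosed : IsClosed {x | f x ≤ Q} := hf.isClosed_preimage Q
  rw [← hclosed.closure_eq]
  exact hcpt Q.toReal _ (fun x hx => ((hφf x).trans hx).trans (EReal.le_coe_toReal hQ)) hbdd

theorem SublevelsCompact.exists_coe_le [BoundedSpace X] {φ : X → EReal}
    (hcpt : SublevelsCompact φ) (hbot : ∀ x, φ x ≠ ⊥) (hlsc : LowerSemicontinuous φ) :
    ∃ b : ℝ, ∀ x, (b : EReal) ≤ φ x := by
  by_cases htop : ∀ x, φ x = ⊤
  · exact ⟨0, fun x => le_top.trans_eq (htop x).symm⟩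
  obtain ⟨y, hy⟩ := not_forall.1 htop
  obtain ⟨w, hw⟩ := exists_forall_le_of_isCompact_sublevel hlsc (y := y)
    (hcpt.isCompact_sublevel hlsc (fun _ => le_rfl) hy (Bornology.IsBounded.all _))
  exact ⟨(φ w).toReal, fun x => (EReal.coe_toReal_le (hbot w)).trans (hw x)⟩

theorem SublevelsCompact.add (hc₁ : SublevelsCompact φ₁) {b : ℝ}
    (hb₂ : ∀ x, (b : EReal) ≤ φ₂ x) : SublevelsCompact (fun x => φ₁ x + φ₂ x) := by
  intro Q S hS
  refine hc₁ (Q - b) S fun x hx => ?_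
  rw [mem_ofPred_eq, EReal.coe_sub,
    EReal.le_sub_iff_add_le (Or.inl (EReal.coe_ne_bot b)) (Or.inl (EReal.coe_ne_top b))]
  exact (add_le_add_right (hb₂ x) (φ₁ x)).trans (hS hx)

end Minimizers

section Prox

variable {X : Type*} [MetricSpace X] {φ : X → EReal} {τ : ℝ} {x z : X}

theorem mem_proxSet_iff :
    z ∈ proxSet φ τ x ↔ ∀ w, φ z + ((dist x z ^ 2 / (2 * τ) : ℝ) : EReal) ≤
      φ w + ((dist x w ^ 2 / (2 * τ) : ℝ) : EReal) :=
  ⟨fun hz w => (show _ = _ from hz).trans_le (iInf_le _ w),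
    fun h => (le_iInf h).antisymm (iInf_le _ z)⟩

theorem ne_top_of_mem_proxSet (hz : z ∈ proxSet φ τ x) {w : X} (hw : φ w ≠ ⊤) : φ z ≠ ⊤ := by
  intro h
  have hle := mem_proxSet_iff.1 hz w
  rw [h, EReal.top_add_coe, top_le_iff] at hle
  exact EReal.add_ne_top hw (EReal.coe_ne_top _) hle

theorem le_of_mem_proxSet (hτ : 0 < τ) (hz : z ∈ proxSet φ τ x) : φ z ≤ φ x := by
  have hle := mem_proxSet_iff.1 hz x
  rw [dist_self, zero_pow two_ne_zero, zero_div, EReal.coe_zero, add_zero] at hle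
  exact (le_add_of_nonneg_right (EReal.coe_nonneg.2 (by positivity))).trans hle

theorem sq_dist_sub_le_of_mem_proxSet (hτ : 0 < τ) (hbot : ∀ x, φ x ≠ ⊥)
    (hz : z ∈ proxSet φ τ x) {w : X} (hw : φ w ≠ ⊤) :
    dist x z ^ 2 - dist x w ^ 2 ≤ 2 * τ * ((φ w).toReal - (φ z).toReal) := by
  have hle := mem_proxSet_iff.1 hz w
  rw [← EReal.coe_toReal hw (hbot w),
    ← EReal.coe_toReal (ne_top_of_mem_proxSet hz hw) (hbot z)] at hle
  norm_cast at hle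
  rw [← div_le_iff₀' (by positivity), sub_div]
  linarith

theorem sq_dist_le_of_mem_proxSet (hτ : 0 < τ) (hbot : ∀ x, φ x ≠ ⊥) (hz : z ∈ proxSet φ τ x)
    (hx : φ x ≠ ⊤) : dist x z ^ 2 ≤ 2 * τ * ((φ x).toReal - (φ z).toReal) := by
  simpa using sq_dist_sub_le_of_mem_proxSet hτ hbot hz hx

theorem mem_proxSet_zero_iff (hτ : 0 < τ) : z ∈ proxSet (fun _ => 0) τ x ↔ z = x := by
  simp only [mem_proxSet_iff, zero_add, EReal.coe_le_coe_iff]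
  refine ⟨fun h => ?_, ?_⟩
  · have hx := h x
    rw [dist_self, div_le_div_iff_of_pos_right (by positivity)] at hx
    exact (dist_eq_zero.1 (pow_eq_zero_iff two_ne_zero |>.1
      (le_antisymm (by simpa using hx) (sq_nonneg _)))).symm
  · rintro rfl w
    rw [dist_self]
    gcongr
    exact dist_nonneg

theorem proxSet_nonempty {b : ℝ} (hb : ∀ x, (b : EReal) ≤ φ x) (hlsc : LowerSemicontinuous φ)
    (hcpt : SublevelsCompact φ) {y : X} (hy : φ y ≠ ⊤) (hτ : 0 < τ) (x : X) :
    (proxSet φ τ x).Nonempty := by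
  set F : X → EReal := fun w => φ w + ((dist x w ^ 2 / (2 * τ) : ℝ) : EReal)
  have hpenalty : Continuous fun w => ((dist x w ^ 2 / (2 * τ) : ℝ) : EReal) :=
    continuous_coe_real_ereal.comp (by fun_prop)
  have hFlsc : LowerSemicontinuous F := lowerSemicontinuous_add (ne_bot_of_coe_le hb)
    (fun _ => EReal.coe_ne_bot _) hlsc hpenalty.lowerSemicontinuous
  have hφF : ∀ w, φ w ≤ F w := fun w =>
    le_add_of_nonneg_right (EReal.coe_nonneg.2 (by positivity))
  have hFy : F y ≠ ⊤ := EReal.add_ne_top hy (EReal.coe_ne_top _)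
  have hbdd : Bornology.IsBounded {w | F w ≤ F y} := by
    refine Metric.isBounded_closedBall (x := x) (r := √(2 * τ * ((F y).toReal - b))) |>.subset
      fun w hw => ?_
    have hle : ((b + dist x w ^ 2 / (2 * τ) : ℝ) : EReal) ≤ ((F y).toReal : EReal) := by
      rw [EReal.coe_add]
      exact ((add_le_add_left (hb w) _).trans hw).trans (EReal.le_coe_toReal hFy)
    rw [Metric.mem_closedBall']
    refine Real.le_sqrt_of_sq_le ?_
    rw [← div_le_iff₀' (by positivity)]
    linarith [EReal.coe_le_coe_iff.1 hle]
  obtain ⟨w, hw⟩ := exists_forall_le_of_isCompact_sublevel hFlsc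
    (hcpt.isCompact_sublevel hFlsc hφF hFy hbdd)
  exact ⟨w, mem_proxSet_iff.2 hw⟩

end Prox

/-! ### Local evolution variational inequalities -/

section LocalEVI

/-- The discrete evolution variational inequality for proximal points of `ψ`, for distances at most
`r` and with a defect of order `K`. -/
def HasLocalEVI {X : Type*} [MetricSpace X] (ψ : X → EReal) (r K : ℝ) : Prop :=
  ∀ τ : ℝ, 0 < τ → ∀ x z y : X, z ∈ proxSet ψ τ x → ψ y ≠ ⊤ → dist x z ≤ r → dist z y ≤ r →
    dist z y ^ 2 ≤ dist x y ^ 2 + K * dist x z ^ 2 +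
      2 * τ * ((ψ y).toReal - (ψ z).toReal) + K * τ * dist z y ^ 2

variable {X : Type*} [MetricSpace X]

theorem HasLocalEVI.zero {r K : ℝ} (hK : 0 ≤ K) : HasLocalEVI (fun _ : X => 0) r K := by
  intro τ hτ x z y hz _ _ _
  obtain rfl := (mem_proxSet_zero_iff hτ).1 hz
  rw [dist_self]
  linarith [mul_nonneg (mul_nonneg hK hτ.le) (sq_nonneg (dist z y))]

theorem ConvexAlong.le_sq_dist_quotient {ψ : X → EReal} {l τ t : ℝ} {x : X} {γ : ℝ → X}
    (hconv : ConvexAlong l ψ γ) (hbot : ∀ x, ψ x ≠ ⊥) (hτ : 0 < τ) (hz : γ 0 ∈ proxSet ψ τ x)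
    (ht : t ∈ Ioc (0 : ℝ) 1) :
    2 * τ * ((ψ (γ 0)).toReal - (ψ (γ 1)).toReal + l / 2 * (1 - t) * dist (γ 0) (γ 1) ^ 2) ≤
      (dist x (γ t) ^ 2 - dist x (γ 0) ^ 2) / t := by
  have hc := hconv t (Ioc_subset_Icc_self ht)
  have hγt : ψ (γ t) ≠ ⊤ := ne_top_of_le_ne_top (EReal.coe_ne_top _) hc
  have hprox := sq_dist_sub_le_of_mem_proxSet hτ hbot hz hγt
  rw [← EReal.coe_toReal hγt (hbot _), EReal.coe_le_coe_iff] at hc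
  rw [le_div_iff₀ ht.1]
  linarith [mul_le_mul_of_nonneg_left hc (by positivity : 0 ≤ 2 * τ)]

theorem IsVariationFamily.hasLocalEVI {r C l K : ℝ} {Γ : Set (ℝ → X)}
    (hΓ : IsVariationFamily r C Γ) {ψ : X → EReal} (hbot : ∀ x, ψ x ≠ ⊥)
    (hconv : IsLConvexAlong Γ l ψ) (hC : C ≤ K) (hl : -l ≤ K) : HasLocalEVI ψ r K := by
  intro τ hτ x z y hz hy hxz hzy
  obtain ⟨γ, hγ, rfl, rfl⟩ := hΓ.joins z y hzy
  have hψ := hconv γ hγ (ne_top_of_mem_proxSet hz hy) hy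
  set d := dist (γ 0) (γ 1)
  have hlim : Tendsto
      (fun t : ℝ => 2 * τ * ((ψ (γ 0)).toReal - (ψ (γ 1)).toReal + l / 2 * (1 - t) * d ^ 2))
      (𝓝[>] 0) (𝓝 (2 * τ * ((ψ (γ 0)).toReal - (ψ (γ 1)).toReal + l / 2 * (1 - 0) * d ^ 2))) :=
    (Continuous.tendsto (by fun_prop) 0).mono_left nhdsWithin_le_nhds
  have hvariation : 2 * τ * ((ψ (γ 0)).toReal - (ψ (γ 1)).toReal + l / 2 * (1 - 0) * d ^ 2) ≤
      dist x (γ 1) ^ 2 - d ^ 2 + C * dist x (γ 0) ^ 2 := by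
    refine le_of_forall_gt_imp_ge_of_dense fun D hD => le_of_tendsto hlim ?_
    filter_upwards [hΓ.firstVariation γ hγ x hxz hzy D hD, Ioc_mem_nhdsGT (zero_lt_one' ℝ)]
      with t hquotient ht
    exact (hψ.le_sq_dist_quotient hbot hτ hz ht).trans hquotient.le
  linarith [mul_le_mul_of_nonneg_right hC (sq_nonneg (dist x (γ 0))),
    mul_le_mul_of_nonneg_right hl (mul_nonneg hτ.le (sq_nonneg d))]

theorem IsLConvexAlong.add {Γ : Set (ℝ → X)} {l₁ l₂ : ℝ} {φ₁ φ₂ : X → EReal}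
    (h₁ : ∀ x, φ₁ x ≠ ⊥) (h₂ : ∀ x, φ₂ x ≠ ⊥) (hconv₁ : IsLConvexAlong Γ l₁ φ₁)
    (hconv₂ : IsLConvexAlong Γ l₂ φ₂) : IsLConvexAlong Γ (l₁ + l₂) (fun x => φ₁ x + φ₂ x) := by
  intro γ hγ h0 h1 t ht
  obtain ⟨a0, b0⟩ := ne_top_of_add_ne_top h₁ h₂ h0
  obtain ⟨a1, b1⟩ := ne_top_of_add_ne_top h₁ h₂ h1
  refine (add_le_add (hconv₁ γ hγ a0 a1 t ht) (hconv₂ γ hγ b0 b1 t ht)).trans ?_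
  rw [EReal.toReal_add a0 (h₁ _) b0 (h₂ _), EReal.toReal_add a1 (h₁ _) b1 (h₂ _),
    ← EReal.coe_add, EReal.coe_le_coe_iff]
  linarith

end LocalEVI

/-! ### Partitions -/

namespace TimePartition

theorem t_nonneg (P : TimePartition) (k : ℕ) : 0 ≤ P.t k :=
  P.t_zero ▸ P.strictMono.monotone k.zero_le

theorem step_pos (P : TimePartition) (k : ℕ) : 0 < P.step k :=
  sub_pos.2 (P.strictMono k.lt_succ_self)

theorem t_succ (P : TimePartition) (k : ℕ) : P.t (k + 1) = P.t k + P.step k :=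
  (add_sub_cancel _ _).symm

theorem t_le_succ (P : TimePartition) (k : ℕ) : P.t k ≤ P.t (k + 1) :=
  P.strictMono.monotone k.le_succ

theorem step_le_of_mesh_le {P : TimePartition} {m : ℝ} (h : P.mesh ≤ (m : EReal)) (k : ℕ) :
    P.step k ≤ m :=
  EReal.coe_le_coe_iff.1 ((le_iSup (fun k : ℕ => ((P.step k : ℝ) : EReal)) k).trans h)

theorem exists_abs_sub_le (P : TimePartition) {m s : ℝ} (hm : ∀ k, P.step k ≤ m) (hs : 0 ≤ s)
    {j : ℕ} (hj : s ≤ P.t (j + 1)) : ∃ i ≤ j, |P.t i - s| ≤ m := by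
  classical
  have hex : ∃ i, s ≤ P.t (i + 1) := ⟨j, hj⟩
  refine ⟨Nat.find hex, Nat.find_min' hex hj, ?_⟩
  have hle : P.t (Nat.find hex) ≤ s := by
    rcases h : Nat.find hex with _ | i
    · exact P.t_zero.trans_le hs
    · exact (not_le.1 (Nat.find_min hex (h ▸ i.lt_succ_self))).le
  have hlt : s ≤ P.t (Nat.find hex) + P.step (Nat.find hex) := P.t_succ _ ▸ Nat.find_spec hex
  rw [abs_sub_comm, abs_of_nonneg (sub_nonneg.2 hle)]
  linarith [hm (Nat.find hex)]

end TimePartition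

/-! ### Sequences with a discrete evolution variational inequality -/

/-- Up to time `T`, the sequence `z` satisfies the discrete evolution variational inequality of `ψ`
at all points of `D(ψ)` that are `r`-close to it, with an error controlled by `g`. The numbers `g k`
stand for the dissipation in the `k`-th step; their sums are bounded by `M`. -/
structure IsEVISeq {X : Type*} [MetricSpace X] (ψ : X → EReal) (r Λ M T m : ℝ)
    (P : TimePartition) (z : ℕ → X) (g : ℕ → ℝ) : Prop where
  step_le : ∀ k, P.step k ≤ m
  ne_top : ∀ k, P.t k ≤ T → ψ (z k) ≠ ⊤
  nonneg : ∀ k, P.t (k + 1) ≤ T → 0 ≤ g k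
  sum_le : ∀ N, P.t N ≤ T → ∑ k ∈ Finset.range N, g k ≤ M
  sq_dist_le : ∀ k, P.t (k + 1) ≤ T → dist (z k) (z (k + 1)) ^ 2 ≤ P.step k * g k
  evi : ∀ k, P.t (k + 1) ≤ T → ∀ y, ψ y ≠ ⊤ → dist (z (k + 1)) y ≤ r →
    dist (z (k + 1)) y ^ 2 ≤ (1 + Λ * P.step k) * dist (z k) y ^ 2 +
      2 * P.step k * ((ψ y).toReal - (ψ (z (k + 1))).toReal) + Λ * P.step k * g k

/-- The accumulated error of the first `j` variational inequalities of an `IsEVISeq`. -/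
def errorSum (Λ : ℝ) (P : TimePartition) (g : ℕ → ℝ) (j : ℕ) : ℝ :=
  ∑ i ∈ Finset.range j, Λ * P.step i * g i

theorem errorSum_succ (Λ : ℝ) (P : TimePartition) (g : ℕ → ℝ) (j : ℕ) :
    errorSum Λ P g (j + 1) = errorSum Λ P g j + Λ * P.step j * g j :=
  Finset.sum_range_succ _ _

theorem add_sq_le_of_sq_le_mul {a b S G τ g : ℝ} (hS : 0 ≤ S) (hG : 0 ≤ G) (hτ : 0 ≤ τ)
    (hg : 0 ≤ g) (ha : a ^ 2 ≤ S * G) (hb : b ^ 2 ≤ τ * g) :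
    (a + b) ^ 2 ≤ (S + τ) * (G + g) := by
  have hmul : (a * b) ^ 2 ≤ (S * G) * (τ * g) := by
    rw [mul_pow]
    exact mul_le_mul ha hb (sq_nonneg _) (by positivity)
  have hab : 2 * (a * b) ≤ S * g + τ * G :=
    le_of_sq_le_sq (by nlinarith [sq_nonneg (S * g - τ * G)]) (by positivity)
  nlinarith

namespace IsEVISeq

variable {X : Type*} [MetricSpace X] {ψ : X → EReal} {r Λ M T m : ℝ} {P : TimePartition}
  {z : ℕ → X} {g : ℕ → ℝ}

theorem mesh_nonneg (h : IsEVISeq ψ r Λ M T m P z g) : 0 ≤ m :=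
  (P.step_pos 0).le.trans (h.step_le 0)

theorem bound_nonneg (h : IsEVISeq ψ r Λ M T m P z g) (hT : 0 ≤ T) : 0 ≤ M := by
  simpa only [Finset.range_zero, Finset.sum_empty] using h.sum_le 0 (P.t_zero.trans_le hT)

theorem nonneg_of_lt (h : IsEVISeq ψ r Λ M T m P z g) {i j : ℕ} (hij : i < j) (hj : P.t j ≤ T) :
    0 ≤ g i :=
  h.nonneg i ((P.strictMono.monotone hij).trans hj)

theorem sq_dist_le_mul_sum (h : IsEVISeq ψ r Λ M T m P z g) (i n : ℕ) (hn : P.t (i + n) ≤ T) :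
    dist (z i) (z (i + n)) ^ 2 ≤ (P.t (i + n) - P.t i) * ∑ k ∈ Finset.range n, g (i + k) := by
  induction n with
  | zero => simp
  | succ n ih =>
    have hn' : P.t (i + n) ≤ T := (P.t_le_succ _).trans hn
    have hsum : 0 ≤ ∑ k ∈ Finset.range n, g (i + k) := Finset.sum_nonneg fun k hk =>
      h.nonneg_of_lt (Nat.add_lt_add_left (Finset.mem_range.1 hk) i) hn'
    calc dist (z i) (z (i + (n + 1))) ^ 2
        ≤ (dist (z i) (z (i + n)) + dist (z (i + n)) (z (i + n + 1))) ^ 2 :=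
          pow_le_pow_left₀ dist_nonneg (dist_triangle _ _ _) 2
      _ ≤ (P.t (i + n) - P.t i + P.step (i + n)) *
            (∑ k ∈ Finset.range n, g (i + k) + g (i + n)) :=
          add_sq_le_of_sq_le_mul
            (sub_nonneg.2 (P.strictMono.monotone (Nat.le_add_right i n))) hsum
            (P.step_pos _).le (h.nonneg _ hn) (ih hn') (h.sq_dist_le _ hn)
      _ = (P.t (i + (n + 1)) - P.t i) * ∑ k ∈ Finset.range (n + 1), g (i + k) := by
          rw [Finset.sum_range_succ, ← add_assoc, P.t_succ]
          ring

theorem sq_dist_le_mul_sub (h : IsEVISeq ψ r Λ M T m P z g) {i j : ℕ} (hij : i ≤ j)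
    (hj : P.t j ≤ T) : dist (z i) (z j) ^ 2 ≤ M * (P.t j - P.t i) := by
  obtain ⟨n, rfl⟩ := Nat.exists_eq_add_of_le hij
  have hhead : 0 ≤ ∑ k ∈ Finset.range i, g k := Finset.sum_nonneg fun k hk =>
    h.nonneg_of_lt ((Finset.mem_range.1 hk).trans_le hij) hj
  have htail : ∑ k ∈ Finset.range n, g (i + k) ≤ M := by
    have := h.sum_le _ hj
    rw [Finset.sum_range_add] at this
    linarith
  rw [mul_comm M]
  exact (h.sq_dist_le_mul_sum i n hj).trans
    (mul_le_mul_of_nonneg_left htail (sub_nonneg.2 (P.strictMono.monotone hij)))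

theorem errorSum_nonneg (h : IsEVISeq ψ r Λ M T m P z g) (hΛ : 0 ≤ Λ) {j : ℕ} (hj : P.t j ≤ T) :
    0 ≤ errorSum Λ P g j :=
  Finset.sum_nonneg fun k hk => mul_nonneg (mul_nonneg hΛ (P.step_pos k).le)
    (h.nonneg_of_lt (Finset.mem_range.1 hk) hj)

theorem errorSum_le (h : IsEVISeq ψ r Λ M T m P z g) (hΛ : 0 ≤ Λ) {j : ℕ} (hj : P.t j ≤ T) :
    errorSum Λ P g j ≤ Λ * m * M :=
  calc errorSum Λ P g j ≤ ∑ i ∈ Finset.range j, Λ * m * g i :=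
        Finset.sum_le_sum fun k hk => mul_le_mul_of_nonneg_right
          (mul_le_mul_of_nonneg_left (h.step_le k) hΛ) (h.nonneg_of_lt (Finset.mem_range.1 hk) hj)
    _ = Λ * m * ∑ i ∈ Finset.range j, g i := (Finset.mul_sum _ _ _).symm
    _ ≤ Λ * m * M := mul_le_mul_of_nonneg_left (h.sum_le j hj) (mul_nonneg hΛ h.mesh_nonneg)

end IsEVISeq

/-! ### Comparison by doubling the time variable -/

section Doubling

/-- The function of two times which bounds the squared distance of `IsEVISeq`s with a common initial
point, up to accumulated errors and an exponential factor. -/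
noncomputable def majorant (M ε m t s : ℝ) : ℝ :=
  M * (ε + ((t - s) ^ 2 + m * (t + s)) / ε)

variable {M ε m t s : ℝ}

theorem mul_abs_sub_le_majorant (hM : 0 ≤ M) (hε : 0 < ε) (hm : 0 ≤ m) (ht : 0 ≤ t)
    (hs : 0 ≤ s) : M * |t - s| ≤ majorant M ε m t s := by
  refine mul_le_mul_of_nonneg_left ?_ hM
  rw [← sub_le_iff_le_add', le_div_iff₀ hε, ← sq_abs (t - s)]
  nlinarith [sq_nonneg (|t - s| - ε), sq_nonneg |t - s|, mul_nonneg hm (add_nonneg ht hs)]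

theorem majorant_nonneg (hM : 0 ≤ M) (hε : 0 < ε) (hm : 0 ≤ m) (ht : 0 ≤ t) (hs : 0 ≤ s) :
    0 ≤ majorant M ε m t s :=
  (mul_nonneg hM (abs_nonneg _)).trans (mul_abs_sub_le_majorant hM hε hm ht hs)

theorem mul_sq_div_le_majorant {h : ℝ} (hM : 0 ≤ M) (hε : 0 < ε) (hm : 0 ≤ m) (ht : 0 ≤ t)
    (hs : 0 ≤ s) (hh : 0 ≤ h) (hts : h ≤ |t - s|) : M * (h ^ 2 / ε) ≤ majorant M ε m t s := by
  have hsq : h ^ 2 ≤ (t - s) ^ 2 := sq_abs (t - s) ▸ pow_le_pow_left₀ hh hts 2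
  refine mul_le_mul_of_nonneg_left ((div_le_div_of_nonneg_right ?_ hε.le).trans
    (le_add_of_nonneg_left hε.le)) hM
  linarith [mul_nonneg hm (add_nonneg ht hs)]

theorem majorant_le_of_abs_sub_le {T : ℝ} (hM : 0 ≤ M) (hε : 0 < ε) (hm : 0 ≤ m)
    (hts : |t - s| ≤ m) (ht : t ≤ T) (hs : s ≤ T) :
    majorant M ε m t s ≤ M * (ε + (m ^ 2 + 2 * m * T) / ε) := by
  have hsq : (t - s) ^ 2 ≤ m ^ 2 := sq_le_sq' (abs_le.1 hts).1 (abs_le.1 hts).2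
  refine mul_le_mul_of_nonneg_left (add_le_add_right (div_le_div_of_nonneg_right ?_ hε.le) ε) hM
  nlinarith

theorem majorant_recursion {τ σ : ℝ} (hM : 0 ≤ M) (hε : 0 < ε) (hτ : 0 ≤ τ) (hσ : 0 ≤ σ)
    (hτm : τ ≤ m) (hσm : σ ≤ m) :
    σ * majorant M ε m t (s + σ) + τ * majorant M ε m (t + τ) s ≤
      (τ + σ) * majorant M ε m (t + τ) (s + σ) := by
  have hnum : σ * ((t - (s + σ)) ^ 2 + m * (t + (s + σ))) +
      τ * ((t + τ - s) ^ 2 + m * (t + τ + s)) ≤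
      (τ + σ) * ((t + τ - (s + σ)) ^ 2 + m * (t + τ + (s + σ))) := by
    nlinarith [mul_nonneg (mul_nonneg hτ hσ) (sub_nonneg.2 hτm),
      mul_nonneg (mul_nonneg hτ hσ) (sub_nonneg.2 hσm)]
  have hdiv := mul_le_mul_of_nonneg_left (div_le_div_of_nonneg_right hnum hε.le) hM
  rw [add_div, mul_div_assoc, mul_div_assoc, mul_div_assoc] at hdiv
  simp only [majorant]
  linarith

theorem one_add_mul_le_exp_add_mul {x a A B : ℝ} (hx : 0 ≤ x) (hB : 0 ≤ B)
    (hA : A ≤ Real.exp a * B) : (1 + x) * A ≤ Real.exp (a + x) * B :=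
  calc (1 + x) * A ≤ (1 + x) * (Real.exp a * B) := mul_le_mul_of_nonneg_left hA (by positivity)
    _ = Real.exp a * (x + 1) * B := by ring
    _ ≤ Real.exp a * Real.exp x * B := by gcongr; exact Real.add_one_le_exp x
    _ = Real.exp (a + x) * B := by rw [Real.exp_add]

/-- The bound for `d²(z j, w k)` which the doubling argument propagates. -/
noncomputable def doublingBound (Λ M ε m : ℝ) (P Q : TimePartition) (g f : ℕ → ℝ) (j k : ℕ) : ℝ :=
  Real.exp (Λ * (P.t j + Q.t k)) *
    (majorant M ε m (P.t j) (Q.t k) + errorSum Λ P g j + errorSum Λ Q f k)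

theorem eventually_nhdsGT_lt {F : ℝ → ℝ} (hF : Continuous F) {a c : ℝ} (hc : F a < c) :
    ∀ᶠ x in 𝓝[>] a, F x < c :=
  ((hF.tendsto a).eventually_lt_const hc).filter_mono nhdsWithin_le_nhds

namespace IsEVISeq

variable {X : Type*} [MetricSpace X] {ψ : X → EReal} {r Λ T : ℝ} {P Q : TimePartition}
  {z w : ℕ → X} {g f : ℕ → ℝ}

theorem doubling (hz : IsEVISeq ψ r Λ M T m P z g) (hw : IsEVISeq ψ r Λ M T m Q w f) {j k : ℕ}
    (hj : P.t (j + 1) ≤ T) (hk : Q.t (k + 1) ≤ T) (hr : dist (z (j + 1)) (w (k + 1)) ≤ r) :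
    (P.step j + Q.step k) * dist (z (j + 1)) (w (k + 1)) ^ 2 ≤
      Q.step k * ((1 + Λ * P.step j) * dist (z j) (w (k + 1)) ^ 2) +
        P.step j * ((1 + Λ * Q.step k) * dist (z (j + 1)) (w k) ^ 2) +
        (Q.step k * (Λ * P.step j * g j) + P.step j * (Λ * Q.step k * f k)) := by
  have hzw := hz.evi j hj _ (hw.ne_top _ hk) hr
  have hwz := hw.evi k hk _ (hz.ne_top _ hj) (by rwa [dist_comm])
  rw [dist_comm (w (k + 1)), dist_comm (w k)] at hwz
  -- With these weights the values of `ψ` cancel.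
  have hzw' := mul_le_mul_of_nonneg_left hzw (Q.step_pos k).le
  have hwz' := mul_le_mul_of_nonneg_left hwz (P.step_pos j).le
  linarith

theorem majorant_le_doublingBound (hz : IsEVISeq ψ r Λ M T m P z g)
    (hw : IsEVISeq ψ r Λ M T m Q w f) (hΛ : 0 ≤ Λ) (hT : 0 ≤ T) (hε : 0 < ε) {j k : ℕ}
    (hj : P.t j ≤ T) (hk : Q.t k ≤ T) :
    majorant M ε m (P.t j) (Q.t k) ≤ doublingBound Λ M ε m P Q g f j k := by
  have ht := P.t_nonneg j
  have hs := Q.t_nonneg k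
  have hmaj := majorant_nonneg (hz.bound_nonneg hT) hε hz.mesh_nonneg ht hs
  have hE := hz.errorSum_nonneg hΛ hj
  have hF := hw.errorSum_nonneg hΛ hk
  calc majorant M ε m (P.t j) (Q.t k)
      ≤ majorant M ε m (P.t j) (Q.t k) + errorSum Λ P g j + errorSum Λ Q f k := by linarith
    _ ≤ doublingBound Λ M ε m P Q g f j k :=
        le_mul_of_one_le_left (by positivity) (Real.one_le_exp (by positivity))

theorem doublingBound_le (hz : IsEVISeq ψ r Λ M T m P z g) (hw : IsEVISeq ψ r Λ M T m Q w f)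
    (hΛ : 0 ≤ Λ) (hT : 0 ≤ T) (hε : 0 < ε) {j k : ℕ} (hj : P.t j ≤ T) (hk : Q.t k ≤ T)
    (hjk : |P.t j - Q.t k| ≤ m) :
    doublingBound Λ M ε m P Q g f j k ≤
      Real.exp (2 * Λ * T) * (M * (ε + (m ^ 2 + 2 * m * T) / ε) + 2 * (Λ * m * M)) := by
  have hM := hz.bound_nonneg hT
  have hE := hz.errorSum_nonneg hΛ hj
  have hF := hw.errorSum_nonneg hΛ hk
  have hmaj := majorant_nonneg hM hε hz.mesh_nonneg (P.t_nonneg j) (Q.t_nonneg k)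
  refine mul_le_mul (Real.exp_le_exp.2 (by nlinarith)) ?_ (by positivity) (Real.exp_pos _).le
  linarith [majorant_le_of_abs_sub_le hM hε hz.mesh_nonneg hjk hj hk, hz.errorSum_le hΛ hj,
    hw.errorSum_le hΛ hk]

theorem sq_dist_le_doublingBound_succ (hz : IsEVISeq ψ r Λ M T m P z g)
    (hw : IsEVISeq ψ r Λ M T m Q w f) (hΛ : 0 ≤ Λ) (hT : 0 ≤ T) (hε : 0 < ε) {j k : ℕ}
    (hj : P.t (j + 1) ≤ T) (hk : Q.t (k + 1) ≤ T) (hr : dist (z (j + 1)) (w (k + 1)) ≤ r)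
    (hjk : dist (z j) (w (k + 1)) ^ 2 ≤ doublingBound Λ M ε m P Q g f j (k + 1))
    (hkj : dist (z (j + 1)) (w k) ^ 2 ≤ doublingBound Λ M ε m P Q g f (j + 1) k) :
    dist (z (j + 1)) (w (k + 1)) ^ 2 ≤ doublingBound Λ M ε m P Q g f (j + 1) (k + 1) := by
  have hτ := P.step_pos j
  have hσ := Q.step_pos k
  have he := mul_nonneg (mul_nonneg hΛ hτ.le) (hz.nonneg j hj)
  have hf := mul_nonneg (mul_nonneg hΛ hσ.le) (hw.nonneg k hk)
  have hbound {j k : ℕ} (hj : P.t j ≤ T) (hk : Q.t k ≤ T) :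
      0 ≤ majorant M ε m (P.t j) (Q.t k) + errorSum Λ P g j + errorSum Λ Q f k :=
    add_nonneg (add_nonneg (majorant_nonneg (hz.bound_nonneg hT) hε hz.mesh_nonneg
      (P.t_nonneg j) (Q.t_nonneg k)) (hz.errorSum_nonneg hΛ hj)) (hw.errorSum_nonneg hΛ hk)
  have hexp := Real.one_le_exp
    (mul_nonneg hΛ (add_nonneg (P.t_nonneg (j + 1)) (Q.t_nonneg (k + 1))))
  have hjk' := one_add_mul_le_exp_add_mul (mul_nonneg hΛ hτ.le)
    (hbound ((P.t_le_succ j).trans hj) hk) hjk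
  have hkj' := one_add_mul_le_exp_add_mul (mul_nonneg hΛ hσ.le)
    (hbound hj ((Q.t_le_succ k).trans hk)) hkj
  have hrec := majorant_recursion (t := P.t j) (s := Q.t k) (hz.bound_nonneg hT) hε hτ.le hσ.le
    (hz.step_le j) (hw.step_le k)
  have hdbl := hz.doubling hw hj hk hr
  simp only [doublingBound, errorSum_succ, P.t_succ, Q.t_succ] at hjk' hkj' hexp ⊢
  rw [← mul_add, add_right_comm] at hjk'
  rw [← mul_add, add_assoc] at hkj'
  set p := Real.exp (Λ * (P.t j + P.step j + (Q.t k + Q.step k)))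
  refine le_of_mul_le_mul_left (hdbl.trans ?_) (add_pos hτ hσ)
  linarith [mul_le_mul_of_nonneg_left hjk' hσ.le, mul_le_mul_of_nonneg_left hkj' hτ.le,
    mul_le_mul_of_nonneg_left hrec (zero_le_one.trans hexp),
    le_mul_of_one_le_left (mul_nonneg hσ.le he) hexp,
    le_mul_of_one_le_left (mul_nonneg hτ.le hf) hexp]

theorem sq_dist_le_mul_add (hz : IsEVISeq ψ r Λ M T m P z g) (hw : IsEVISeq ψ r Λ M T m Q w f)
    (h₀ : z 0 = w 0) {j k : ℕ} (hj : P.t j ≤ T) (hk : Q.t k ≤ T) :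
    dist (z j) (w k) ^ 2 ≤ 2 * M * (P.t j + Q.t k) := by
  have hzj := hz.sq_dist_le_mul_sub j.zero_le hj
  have hwk := hw.sq_dist_le_mul_sub k.zero_le hk
  rw [P.t_zero, sub_zero] at hzj
  rw [Q.t_zero, sub_zero, ← h₀] at hwk
  calc dist (z j) (w k) ^ 2 ≤ (dist (z 0) (z j) + dist (z 0) (w k)) ^ 2 :=
        pow_le_pow_left₀ dist_nonneg (dist_triangle_left _ _ _) 2
    _ ≤ 2 * (dist (z 0) (z j) ^ 2 + dist (z 0) (w k) ^ 2) := add_sq_le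
    _ ≤ 2 * M * (P.t j + Q.t k) := by linarith

theorem sq_dist_le_majorant_of_far (hz : IsEVISeq ψ r Λ M T m P z g)
    (hw : IsEVISeq ψ r Λ M T m Q w f) (h₀ : z 0 = w 0) (hT : 0 ≤ T) (hε : 0 < ε) {h : ℝ}
    (hh : 0 ≤ h) (hεh : 4 * T * ε ≤ h ^ 2) {j k : ℕ} (hj : P.t j ≤ T) (hk : Q.t k ≤ T)
    (hfar : h ≤ |P.t j - Q.t k|) :
    dist (z j) (w k) ^ 2 ≤ majorant M ε m (P.t j) (Q.t k) := by
  have hM := hz.bound_nonneg hT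
  calc dist (z j) (w k) ^ 2 ≤ 2 * M * (P.t j + Q.t k) := hz.sq_dist_le_mul_add hw h₀ hj hk
    _ ≤ M * (4 * T) := by nlinarith
    _ ≤ M * (h ^ 2 / ε) := mul_le_mul_of_nonneg_left ((le_div_iff₀ hε).2 hεh) hM
    _ ≤ majorant M ε m (P.t j) (Q.t k) := mul_sq_div_le_majorant hM hε hz.mesh_nonneg
        (P.t_nonneg j) (Q.t_nonneg k) hh hfar

theorem dist_le_of_diagonal (hz : IsEVISeq ψ r Λ M T m P z g) (hr : 0 ≤ r) (hM : 0 ≤ M) {h : ℝ}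
    (hh : M * (h + m) ≤ (r / 2) ^ 2) {j k : ℕ} (hj : P.t (j + 1) ≤ T)
    (hle : Q.t k ≤ P.t (j + 1)) (hnear : P.t (j + 1) - Q.t k ≤ h)
    (hdiag : ∀ i ≤ j, |P.t i - Q.t k| ≤ m → dist (z i) (w k) ≤ r / 2) :
    dist (z (j + 1)) (w k) ≤ r := by
  obtain ⟨i, hij, hi⟩ := P.exists_abs_sub_le hz.step_le (Q.t_nonneg k) hle
  have hsq : dist (z i) (z (j + 1)) ^ 2 ≤ (r / 2) ^ 2 :=
    ((hz.sq_dist_le_mul_sub (hij.trans j.le_succ) hj).trans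
      (mul_le_mul_of_nonneg_left (by linarith [(abs_le.1 hi).1]) hM)).trans hh
  have hz_near : dist (z i) (z (j + 1)) ≤ r / 2 := le_of_sq_le_sq hsq (by positivity)
  linarith [dist_triangle_left (z (j + 1)) (w k) (z i), hdiag i hij hi]

theorem dist_le_of_near (hz : IsEVISeq ψ r Λ M T m P z g) (hw : IsEVISeq ψ r Λ M T m Q w f)
    (hr : 0 ≤ r) (hM : 0 ≤ M) {h : ℝ} (hh : M * (h + m) ≤ (r / 2) ^ 2) {j k : ℕ}
    (hj : P.t (j + 1) ≤ T) (hk : Q.t (k + 1) ≤ T) (hnear : |P.t (j + 1) - Q.t (k + 1)| ≤ h)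
    (hdiag : ∀ i l, i ≤ j + 1 → l ≤ k + 1 → i + l < j + 1 + (k + 1) → |P.t i - Q.t l| ≤ m →
      dist (z i) (w l) ≤ r / 2) :
    dist (z (j + 1)) (w (k + 1)) ≤ r := by
  rcases le_total (Q.t (k + 1)) (P.t (j + 1)) with hle | hle
  · exact hz.dist_le_of_diagonal hr hM hh hj hle ((le_abs_self _).trans hnear)
      fun i hi => hdiag i (k + 1) (by omega) le_rfl (by omega)
  · rw [dist_comm]
    refine hw.dist_le_of_diagonal hr hM hh hk hle ((neg_sub _ _).symm.trans_le
      ((neg_le_abs _).trans hnear)) fun i hi him => ?_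
    rw [dist_comm]
    exact hdiag (j + 1) i le_rfl (by omega) (by omega) (by rwa [abs_sub_comm])

theorem sq_dist_le_doublingBound (hz : IsEVISeq ψ r Λ M T m P z g)
    (hw : IsEVISeq ψ r Λ M T m Q w f) (h₀ : z 0 = w 0) (hr : 0 ≤ r) (hΛ : 0 ≤ Λ) (hT : 0 ≤ T)
    (hε : 0 < ε) {h : ℝ} (hh : 0 ≤ h) (hεh : 4 * T * ε ≤ h ^ 2) (hMh : M * (h + m) ≤ (r / 2) ^ 2)
    (hdiag : Real.exp (2 * Λ * T) * (M * (ε + (m ^ 2 + 2 * m * T) / ε) + 2 * (Λ * m * M)) ≤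
      (r / 2) ^ 2) (j k : ℕ) (hj : P.t j ≤ T) (hk : Q.t k ≤ T) :
    dist (z j) (w k) ^ 2 ≤ doublingBound Λ M ε m P Q g f j k := by
  have hM := hz.bound_nonneg hT
  have hm := hz.mesh_nonneg
  induction hn : j + k using Nat.strong_induction_on generalizing j k with
  | _ n ih =>
  subst hn
  have hmaj := hz.majorant_le_doublingBound hw hΛ hT hε hj hk
  have hlin := (mul_abs_sub_le_majorant hM hε hm (P.t_nonneg j) (Q.t_nonneg k)).trans hmaj
  rcases j with _ | j
  · refine le_trans ?_ hlin
    simpa only [h₀, P.t_zero, Q.t_zero, zero_sub, abs_neg, sub_zero, abs_of_nonneg (Q.t_nonneg k)]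
      using hw.sq_dist_le_mul_sub k.zero_le hk
  rcases k with _ | k
  · refine le_trans ?_ hlin
    simpa only [← h₀, dist_comm (z (j + 1)), P.t_zero, Q.t_zero, sub_zero,
      abs_of_nonneg (P.t_nonneg (j + 1))] using hz.sq_dist_le_mul_sub (j + 1).zero_le hj
  rcases le_total h |P.t (j + 1) - Q.t (k + 1)| with hfar | hnear
  · exact (hz.sq_dist_le_majorant_of_far hw h₀ hT hε hh hεh hj hk hfar).trans hmaj
  have hdist : dist (z (j + 1)) (w (k + 1)) ≤ r := by
    refine hz.dist_le_of_near hw hr hM hMh hj hk hnear fun i l hi hl hil him => ?_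
    have hi' := (P.strictMono.monotone hi).trans hj
    have hl' := (Q.strictMono.monotone hl).trans hk
    exact le_of_sq_le_sq ((ih _ hil i l hi' hl' rfl).trans
      ((hz.doublingBound_le hw hΛ hT hε hi' hl' him).trans hdiag)) (by positivity)
  exact hz.sq_dist_le_doublingBound_succ hw hΛ hT hε hj hk hdist
    (ih _ (by omega) _ _ ((P.t_le_succ j).trans hj) hk rfl)
    (ih _ (by omega) _ _ hj ((Q.t_le_succ k).trans hk) rfl)

theorem eventually_dist_le (ψ : X → EReal) (M : ℝ) {ρ : ℝ} (hr : 0 < r) (hΛ : 0 ≤ Λ) (hT : 0 ≤ T)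
    (hρ : 0 < ρ) : ∀ᶠ m in 𝓝[>] (0 : ℝ), ∀ (P Q : TimePartition) (z w : ℕ → X) (g f : ℕ → ℝ),
      IsEVISeq ψ r Λ M T m P z g → IsEVISeq ψ r Λ M T m Q w f → z 0 = w 0 →
        ∀ j k, P.t j ≤ T → Q.t k ≤ T → |P.t j - Q.t k| ≤ m → dist (z j) (w k) ≤ ρ := by
  set ρ' := min ρ (r / 2)
  have hρ' : 0 < ρ' := lt_min hρ (half_pos hr)
  have hMh : ∀ᶠ h in 𝓝[>] (0 : ℝ), M * h < (r / 2) ^ 2 :=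
    eventually_nhdsGT_lt (by fun_prop) (by rw [mul_zero]; positivity)
  obtain ⟨h, hMh, hh : 0 < h⟩ := (hMh.and self_mem_nhdsWithin).exists
  have hεh : ∀ᶠ ε in 𝓝[>] (0 : ℝ), 4 * T * ε < h ^ 2 :=
    eventually_nhdsGT_lt (by fun_prop) (by rw [mul_zero]; positivity)
  have hεM : ∀ᶠ ε in 𝓝[>] (0 : ℝ), Real.exp (2 * Λ * T) * (M * ε) < ρ' ^ 2 :=
    eventually_nhdsGT_lt (by fun_prop) (by rw [mul_zero, mul_zero]; positivity)
  obtain ⟨ε, ⟨hεh, hεM⟩, hε : 0 < ε⟩ := ((hεh.and hεM).and self_mem_nhdsWithin).exists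
  have hMhm : ∀ᶠ m in 𝓝[>] (0 : ℝ), M * (h + m) < (r / 2) ^ 2 :=
    eventually_nhdsGT_lt (by fun_prop) (by simpa using hMh)
  have hdiag : ∀ᶠ m in 𝓝[>] (0 : ℝ), Real.exp (2 * Λ * T) *
      (M * (ε + (m ^ 2 + 2 * m * T) / ε) + 2 * (Λ * m * M)) < ρ' ^ 2 :=
    eventually_nhdsGT_lt (by fun_prop) (by simpa using hεM)
  filter_upwards [hMhm, hdiag] with m hMhm hdiag P Q z w g f hz hw h₀ j k hj hk hjk
  have hρr : ρ' ^ 2 ≤ (r / 2) ^ 2 := pow_le_pow_left₀ hρ'.le (min_le_right _ _) 2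
  have hsq : dist (z j) (w k) ^ 2 ≤ ρ' ^ 2 :=
    (hz.sq_dist_le_doublingBound hw h₀ hr.le hΛ hT hε hh.le hεh.le hMhm.le (hdiag.le.trans hρr)
      j k hj hk).trans ((hz.doublingBound_le hw hΛ hT hε hj hk hjk).trans hdiag.le)
  exact (le_of_sq_le_sq hsq hρ'.le).trans (min_le_left _ _)

end IsEVISeq

end Doubling

/-! ### The alternating scheme -/

theorem ereal_coe_sum {ι : Type*} (s : Finset ι) (f : ι → ℝ) :
    ((∑ i ∈ s, f i : ℝ) : EReal) = ∑ i ∈ s, (f i : EReal) :=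
  map_sum (⟨⟨Real.toEReal, EReal.coe_zero⟩, EReal.coe_add⟩ : ℝ →+ EReal) f s

theorem ne_top_of_sub_ne_top {a b : EReal} (hb : b ≠ ⊤) (h : a - b ≠ ⊤) : a ≠ ⊤ := by
  rintro rfl
  exact h (EReal.top_sub hb)

theorem toReal_sub_toReal_le {a b c : EReal} (ha : a ≠ ⊤) (ha' : a ≠ ⊥) (hb : b ≠ ⊤) (hb' : b ≠ ⊥)
    (hc : c ≠ ⊤) (h : a - b ≤ c) : a.toReal - b.toReal ≤ c.toReal := by
  rw [← EReal.toReal_sub ha ha' hb hb']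
  refine EReal.toReal_le_toReal h ?_ hc
  lift a to ℝ using ⟨ha, ha'⟩
  lift b to ℝ using ⟨hb, hb'⟩
  exact EReal.coe_ne_bot (a - b)

section Increment

variable {X : Type*} {φ₁ φ₂ : X → EReal} {zh z : ℕ → X} {k : ℕ}

theorem increment_nonneg (φ₁ φ₂ : X → EReal) (zh z : ℕ → X) (k : ℕ) :
    0 ≤ increment φ₁ φ₂ zh z k :=
  le_max_left _ _

theorem sub_le_increment_left (φ₁ φ₂ : X → EReal) (zh z : ℕ → X) (k : ℕ) :
    φ₂ (zh (k + 1)) - φ₂ (z k) ≤ increment φ₁ φ₂ zh z k :=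
  (le_max_left _ _).trans (le_max_right _ _)

theorem sub_le_increment_right (φ₁ φ₂ : X → EReal) (zh z : ℕ → X) (k : ℕ) :
    φ₁ (z (k + 1)) - φ₁ (zh (k + 1)) ≤ increment φ₁ φ₂ zh z k :=
  (le_max_right _ _).trans (le_max_right _ _)

theorem increment_zero_right (φ : X → EReal) (x : ℕ → X) (k : ℕ) :
    increment φ (fun _ => 0) x x k = 0 := by
  simp [increment, EReal.sub_self_le_zero]

theorem increment_ne_top {N : ℕ} {Δ : ℝ}
    (h : ∑ k ∈ Finset.range N, increment φ₁ φ₂ zh z k ≤ (Δ : EReal)) (hk : k < N) :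
    increment φ₁ φ₂ zh z k ≠ ⊤ :=
  ne_top_of_le_ne_top (EReal.coe_ne_top Δ) ((Finset.single_le_sum
    (fun i _ => increment_nonneg φ₁ φ₂ zh z i) (Finset.mem_range.2 hk)).trans h)

theorem sum_toReal_increment_le {N : ℕ} {Δ : ℝ}
    (h : ∑ k ∈ Finset.range N, increment φ₁ φ₂ zh z k ≤ (Δ : EReal)) :
    ∑ k ∈ Finset.range N, (increment φ₁ φ₂ zh z k).toReal ≤ Δ := by
  rw [← EReal.coe_le_coe_iff, ereal_coe_sum]
  refine le_of_eq_of_le (Finset.sum_congr rfl fun k hk => ?_) h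
  exact EReal.coe_toReal (increment_ne_top h (Finset.mem_range.1 hk))
    (ne_bot_of_le_ne_bot EReal.zero_ne_bot (increment_nonneg φ₁ φ₂ zh z k))

end Increment

theorem exists_isSplitSolution {X : Type*} [MetricSpace X] {φ₁ φ₂ : X → EReal}
    (h₁ : ∀ τ, 0 < τ → ∀ x, (proxSet φ₁ τ x).Nonempty)
    (h₂ : ∀ τ, 0 < τ → ∀ x, (proxSet φ₂ τ x).Nonempty) (P : TimePartition) (z₀ : X) :
    ∃ zh z, IsSplitSolution φ₁ φ₂ P z₀ zh z := by
  choose J hJ using fun k x => h₁ (P.step k) (P.step_pos k) x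
  choose I hI using fun k x => h₂ (P.step k) (P.step_pos k) x
  let z : ℕ → X := fun k => Nat.rec z₀ (fun k x => I k (J k x)) k
  exact ⟨fun k => J (k - 1) (z (k - 1)), z, rfl, fun k => ⟨hJ k _, hI k _⟩⟩

theorem HasLocalEVI.comp {X : Type*} [MetricSpace X] {φ₁ φ₂ : X → EReal} {r K τ : ℝ}
    (he₁ : HasLocalEVI φ₁ r K) (he₂ : HasLocalEVI φ₂ r K) (hK : 0 ≤ K) (hτ : 0 < τ) (hτ1 : τ ≤ 1)
    {p h w y : X} (hh : h ∈ proxSet φ₁ τ p) (hw : w ∈ proxSet φ₂ τ h) (hy₁ : φ₁ y ≠ ⊤)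
    (hy₂ : φ₂ y ≠ ⊤) (hph : dist p h ≤ r / 2) (hhw : dist h w ≤ r / 2) (hwy : dist w y ≤ r / 2) :
    dist w y ^ 2 ≤ (1 + 4 * K * τ) * dist p y ^ 2 + 7 * K * (dist p h ^ 2 + dist h w ^ 2) +
      2 * τ * ((φ₁ y).toReal + (φ₂ y).toReal - ((φ₁ h).toReal + (φ₂ w).toReal)) := by
  have hr : 0 ≤ r / 2 := dist_nonneg.trans hph
  have hevi₁ := he₁ τ hτ p h y hh hy₁ (by linarith) (by linarith [dist_triangle h w y])
  have hevi₂ := he₂ τ hτ h w y hw hy₂ (by linarith) (by linarith)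
  have hhy : dist h y ^ 2 ≤ 2 * (dist p h ^ 2 + dist p y ^ 2) :=
    (pow_le_pow_left₀ dist_nonneg (dist_triangle_left h y p) 2).trans add_sq_le
  have hpw : dist p w ^ 2 ≤ 2 * (dist p h ^ 2 + dist h w ^ 2) :=
    (pow_le_pow_left₀ dist_nonneg (dist_triangle p h w) 2).trans add_sq_le
  have hwy : dist w y ^ 2 ≤ 2 * (dist p w ^ 2 + dist p y ^ 2) :=
    (pow_le_pow_left₀ dist_nonneg (dist_triangle_left w y p) 2).trans add_sq_le
  have hquad : K * τ * (dist h y ^ 2 + dist w y ^ 2) ≤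
      K * τ * (4 * dist p y ^ 2 + 6 * (dist p h ^ 2 + dist h w ^ 2)) :=
    mul_le_mul_of_nonneg_left (by linarith [sq_nonneg (dist h w)]) (mul_nonneg hK hτ.le)
  have hτE : K * (dist p h ^ 2 + dist h w ^ 2) * τ ≤ K * (dist p h ^ 2 + dist h w ^ 2) :=
    mul_le_of_le_one_right (by positivity) hτ1
  linarith

/-- An upper bound, up to the factor `P.step k`, for the squared length of the `k`-th step of the
alternating scheme: the loss of energy, corrected by the increment `δ^{k+1}`. -/
noncomputable def dissipation {X : Type*} (φ₁ φ₂ : X → EReal) (zh z : ℕ → X) (k : ℕ) : ℝ :=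
  4 * ((φ₁ (z k) + φ₂ (z k)).toReal - (φ₁ (z (k + 1)) + φ₂ (z (k + 1))).toReal +
    3 * (increment φ₁ φ₂ zh z k).toReal)

namespace IsSplitSolution

variable {X : Type*} [MetricSpace X] {φ₁ φ₂ : X → EReal} {P : TimePartition} {z₀ : X}
  {zh z : ℕ → X} {k : ℕ}

theorem ne_top_succ (hz : IsSplitSolution φ₁ φ₂ P z₀ zh z) (hk : increment φ₁ φ₂ zh z k ≠ ⊤)
    (h₁ : φ₁ (z k) ≠ ⊤) (h₂ : φ₂ (z k) ≠ ⊤) :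
    (φ₁ (zh (k + 1)) ≠ ⊤ ∧ φ₂ (zh (k + 1)) ≠ ⊤) ∧ φ₁ (z (k + 1)) ≠ ⊤ ∧ φ₂ (z (k + 1)) ≠ ⊤ := by
  have hh₁ := ne_top_of_mem_proxSet (hz.2 k).1 h₁
  have hh₂ := ne_top_of_sub_ne_top h₂
    (ne_top_of_le_ne_top hk (sub_le_increment_left φ₁ φ₂ zh z k))
  exact ⟨⟨hh₁, hh₂⟩, ne_top_of_sub_ne_top hh₁ (ne_top_of_le_ne_top hk
    (sub_le_increment_right φ₁ φ₂ zh z k)), ne_top_of_mem_proxSet (hz.2 k).2 hh₂⟩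

theorem ne_top (hz : IsSplitSolution φ₁ φ₂ P z₀ zh z)
    (hinc : ∀ i < k, increment φ₁ φ₂ zh z i ≠ ⊤) (h₁ : φ₁ z₀ ≠ ⊤) (h₂ : φ₂ z₀ ≠ ⊤) :
    φ₁ (z k) ≠ ⊤ ∧ φ₂ (z k) ≠ ⊤ := by
  induction k with
  | zero => exact hz.1 ▸ ⟨h₁, h₂⟩
  | succ k ih =>
    obtain ⟨hk₁, hk₂⟩ := ih fun i hi => hinc i (hi.trans k.lt_succ_self)
    exact (hz.ne_top_succ (hinc k k.lt_succ_self) hk₁ hk₂).2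

section Step

variable (hz : IsSplitSolution φ₁ φ₂ P z₀ zh z) (hb₁ : ∀ x, φ₁ x ≠ ⊥) (hb₂ : ∀ x, φ₂ x ≠ ⊥)
  (hk : increment φ₁ φ₂ zh z k ≠ ⊤) (h₁ : φ₁ (z k) ≠ ⊤) (h₂ : φ₂ (z k) ≠ ⊤)
include hz hb₁ hb₂ hk h₁ h₂

theorem energy_le : dist (z k) (zh (k + 1)) ^ 2 + dist (zh (k + 1)) (z (k + 1)) ^ 2 +
    2 * P.step k * (increment φ₁ φ₂ zh z k).toReal ≤
      P.step k * dissipation φ₁ φ₂ zh z k / 2 := by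
  obtain ⟨⟨hh₁, hh₂⟩, hw₁, hw₂⟩ := hz.ne_top_succ hk h₁ h₂
  have hd₁ := sq_dist_le_of_mem_proxSet (P.step_pos k) hb₁ (hz.2 k).1 h₁
  have hd₂ := sq_dist_le_of_mem_proxSet (P.step_pos k) hb₂ (hz.2 k).2 hh₂
  have hδ₁ := mul_le_mul_of_nonneg_left (toReal_sub_toReal_le hw₁ (hb₁ _) hh₁ (hb₁ _) hk
    (sub_le_increment_right φ₁ φ₂ zh z k)) (P.step_pos k).le
  have hδ₂ := mul_le_mul_of_nonneg_left (toReal_sub_toReal_le hh₂ (hb₂ _) h₂ (hb₂ _) hk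
    (sub_le_increment_left φ₁ φ₂ zh z k)) (P.step_pos k).le
  rw [dissipation, EReal.toReal_add h₁ (hb₁ _) h₂ (hb₂ _),
    EReal.toReal_add hw₁ (hb₁ _) hw₂ (hb₂ _)]
  linarith

theorem sq_dist_le : dist (z k) (z (k + 1)) ^ 2 ≤ P.step k * dissipation φ₁ φ₂ zh z k := by
  have henergy := hz.energy_le hb₁ hb₂ hk h₁ h₂
  have hδ : 0 ≤ P.step k * (increment φ₁ φ₂ zh z k).toReal :=
    mul_nonneg (P.step_pos k).le (EReal.toReal_nonneg (increment_nonneg φ₁ φ₂ zh z k))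
  have htri : dist (z k) (z (k + 1)) ^ 2 ≤
      (dist (z k) (zh (k + 1)) + dist (zh (k + 1)) (z (k + 1))) ^ 2 :=
    pow_le_pow_left₀ dist_nonneg (dist_triangle _ _ _) 2
  linarith [add_sq_le (a := dist (z k) (zh (k + 1))) (b := dist (zh (k + 1)) (z (k + 1)))]

theorem dissipation_nonneg : 0 ≤ dissipation φ₁ φ₂ zh z k :=
  nonneg_of_mul_nonneg_right ((sq_nonneg _).trans (hz.sq_dist_le hb₁ hb₂ hk h₁ h₂)) (P.step_pos k)

theorem evi {r K : ℝ} (he₁ : HasLocalEVI φ₁ r K) (he₂ : HasLocalEVI φ₂ r K) (hr : 0 ≤ r)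
    (hK : 0 ≤ K) (hstep : P.step k ≤ 1)
    (hsmall : P.step k * dissipation φ₁ φ₂ zh z k ≤ (r / 2) ^ 2)
    {y : X} (hy₁ : φ₁ y ≠ ⊤) (hy₂ : φ₂ y ≠ ⊤) (hyr : dist (z (k + 1)) y ≤ r / 2) :
    dist (z (k + 1)) y ^ 2 ≤ (1 + (4 * K + 1) * P.step k) * dist (z k) y ^ 2 +
      2 * P.step k * ((φ₁ y + φ₂ y).toReal - (φ₁ (z (k + 1)) + φ₂ (z (k + 1))).toReal) +
      (4 * K + 1) * P.step k * dissipation φ₁ φ₂ zh z k := by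
  obtain ⟨⟨hh₁, -⟩, hw₁, hw₂⟩ := hz.ne_top_succ hk h₁ h₂
  have hδ := mul_le_mul_of_nonneg_left (toReal_sub_toReal_le hw₁ (hb₁ _) hh₁ (hb₁ _) hk
    (sub_le_increment_right φ₁ φ₂ zh z k)) (P.step_pos k).le
  have hδ₀ : 0 ≤ P.step k * (increment φ₁ φ₂ zh z k).toReal :=
    mul_nonneg (P.step_pos k).le (EReal.toReal_nonneg (increment_nonneg φ₁ φ₂ zh z k))
  have henergy := hz.energy_le hb₁ hb₂ hk h₁ h₂
  have hph : dist (z k) (zh (k + 1)) ≤ r / 2 := le_of_sq_le_sq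
    (by linarith [sq_nonneg (dist (zh (k + 1)) (z (k + 1))), sq_nonneg (r / 2)]) (by positivity)
  have hhw : dist (zh (k + 1)) (z (k + 1)) ≤ r / 2 := le_of_sq_le_sq
    (by linarith [sq_nonneg (dist (z k) (zh (k + 1))), sq_nonneg (r / 2)]) (by positivity)
  have hcomp := he₁.comp he₂ hK (P.step_pos k) hstep (hz.2 k).1 (hz.2 k).2 hy₁ hy₂ hph hhw hyr
  have herror := mul_le_mul_of_nonneg_left
    (by linarith : dist (z k) (zh (k + 1)) ^ 2 + dist (zh (k + 1)) (z (k + 1)) ^ 2 ≤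
      P.step k * dissipation φ₁ φ₂ zh z k / 2) hK
  have hg : 0 ≤ P.step k * dissipation φ₁ φ₂ zh z k :=
    (sq_nonneg _).trans (hz.sq_dist_le hb₁ hb₂ hk h₁ h₂)
  rw [EReal.toReal_add hw₁ (hb₁ _) hw₂ (hb₂ _), EReal.toReal_add hy₁ (hb₁ _) hy₂ (hb₂ _)]
  linarith [mul_nonneg hK hg, mul_nonneg (P.step_pos k).le (sq_nonneg (dist (z k) y)),
    sq_nonneg (dist (z k) (zh (k + 1))), sq_nonneg (dist (zh (k + 1)) (z (k + 1)))]

end Step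

section Horizon

variable {T Δ : ℝ} (hz : IsSplitSolution φ₁ φ₂ P z₀ zh z) (hb₁ : ∀ x, φ₁ x ≠ ⊥)
  (hb₂ : ∀ x, φ₂ x ≠ ⊥) (h₁ : φ₁ z₀ ≠ ⊤) (h₂ : φ₂ z₀ ≠ ⊤)
include hz hb₁ hb₂ h₁ h₂

theorem sum_dissipation_le {b : ℝ} (hb : ∀ x, (b : EReal) ≤ φ₁ x + φ₂ x) {N : ℕ}
    (hΔ : ∑ k ∈ Finset.range N, increment φ₁ φ₂ zh z k ≤ (Δ : EReal)) :
    ∑ k ∈ Finset.range N, dissipation φ₁ φ₂ zh z k ≤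
      4 * ((φ₁ z₀ + φ₂ z₀).toReal - b + 3 * Δ) := by
  obtain ⟨hN₁, hN₂⟩ := hz.ne_top (fun _ hi => increment_ne_top hΔ hi) h₁ h₂
  have hbN := hb (z N)
  rw [← EReal.coe_toReal (EReal.add_ne_top hN₁ hN₂) (add_ne_bot hb₁ hb₂ _),
    EReal.coe_le_coe_iff] at hbN
  simp only [dissipation]
  rw [← Finset.mul_sum, Finset.sum_add_distrib, ← Finset.mul_sum,
    Finset.sum_range_sub' (fun k => (φ₁ (z k) + φ₂ (z k)).toReal), hz.1]
  linarith [sum_toReal_increment_le hΔ]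

theorem isEVISeq {r K m b M : ℝ} (he₁ : HasLocalEVI φ₁ r K) (he₂ : HasLocalEVI φ₂ r K)
    (hr : 0 ≤ r) (hK : 0 ≤ K) (hb : ∀ x, (b : EReal) ≤ φ₁ x + φ₂ x)
    (hM : 4 * ((φ₁ z₀ + φ₂ z₀).toReal - b + 3 * Δ) ≤ M) (hmM : m * M ≤ (r / 2) ^ 2) (hm1 : m ≤ 1)
    (hm : ∀ k, P.step k ≤ m)
    (hΔ : ∀ N, P.t N ≤ T → ∑ k ∈ Finset.range N, increment φ₁ φ₂ zh z k ≤ (Δ : EReal)) :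
    IsEVISeq (fun x => φ₁ x + φ₂ x) (r / 2) (4 * K + 1) M T m P z (dissipation φ₁ φ₂ zh z) := by
  have hinc : ∀ k, P.t (k + 1) ≤ T → increment φ₁ φ₂ zh z k ≠ ⊤ := fun k hk =>
    increment_ne_top (hΔ _ hk) k.lt_succ_self
  have hfin : ∀ k, P.t k ≤ T → φ₁ (z k) ≠ ⊤ ∧ φ₂ (z k) ≠ ⊤ := fun k hk =>
    hz.ne_top (fun _ hi => increment_ne_top (hΔ k hk) hi) h₁ h₂
  have hfin' := fun k (hk : P.t (k + 1) ≤ T) => hfin k ((P.t_le_succ k).trans hk)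
  have hnonneg : ∀ k, P.t (k + 1) ≤ T → 0 ≤ dissipation φ₁ φ₂ zh z k := fun k hk =>
    hz.dissipation_nonneg hb₁ hb₂ (hinc k hk) (hfin' k hk).1 (hfin' k hk).2
  have hsum : ∀ N, P.t N ≤ T → ∑ k ∈ Finset.range N, dissipation φ₁ φ₂ zh z k ≤ M := fun N hN =>
    (hz.sum_dissipation_le hb₁ hb₂ h₁ h₂ hb (hΔ N hN)).trans hM
  refine ⟨hm, fun k hk => EReal.add_ne_top (hfin k hk).1 (hfin k hk).2, hnonneg, hsum,
    fun k hk => hz.sq_dist_le hb₁ hb₂ (hinc k hk) (hfin' k hk).1 (hfin' k hk).2,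
    fun k hk y hy hyr => ?_⟩
  have hgM : dissipation φ₁ φ₂ zh z k ≤ M := (Finset.single_le_sum
    (fun i hi => hnonneg i ((P.strictMono.monotone (Finset.mem_range.1 hi)).trans hk))
    (Finset.self_mem_range_succ k)).trans (hsum (k + 1) hk)
  have hsmall : P.step k * dissipation φ₁ φ₂ zh z k ≤ (r / 2) ^ 2 :=
    (mul_le_mul (hm k) hgM (hnonneg k hk) ((P.step_pos k).le.trans (hm k))).trans hmM
  obtain ⟨hy₁, hy₂⟩ := ne_top_of_add_ne_top hb₁ hb₂ hy
  exact hz.evi hb₁ hb₂ (hinc k hk) (hfin' k hk).1 (hfin' k hk).2 he₁ he₂ hr hK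
    ((hm k).trans hm1) hsmall hy₁ hy₂ hyr

end Horizon

end IsSplitSolution

/-! ### Discrete solutions -/

theorem exists_isDiscreteSolution {X : Type*} [MetricSpace X] {φ : X → EReal}
    (h : ∀ τ, 0 < τ → ∀ x, (proxSet φ τ x).Nonempty) (P : TimePartition) (x₀ : X) :
    ∃ x, IsDiscreteSolution φ P x₀ x := by
  choose J hJ using fun k x => h (P.step k) (P.step_pos k) x
  exact ⟨fun k => Nat.rec x₀ J k, rfl, fun k => hJ k _⟩

namespace IsDiscreteSolution

variable {X : Type*} [MetricSpace X] {φ : X → EReal} {P : TimePartition} {x₀ : X} {x : ℕ → X}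

theorem isSplitSolution (hx : IsDiscreteSolution φ P x₀ x) :
    IsSplitSolution φ (fun _ => 0) P x₀ x x :=
  ⟨hx.1, fun k => ⟨hx.2 k, (mem_proxSet_zero_iff (P.step_pos k)).2 rfl⟩⟩

theorem le (hx : IsDiscreteSolution φ P x₀ x) (k : ℕ) : φ (x k) ≤ φ x₀ := by
  induction k with
  | zero => exact (congrArg φ hx.1).le
  | succ k ih => exact (le_of_mem_proxSet (P.step_pos k) (hx.2 k)).trans ih

theorem exists_isEVISeq (hx : IsDiscreteSolution φ P x₀ x) (hbot : ∀ x, φ x ≠ ⊥) (h₀ : φ x₀ ≠ ⊤)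
    {r K m b M : ℝ} (T : ℝ) (he : HasLocalEVI φ r K) (hr : 0 ≤ r) (hK : 0 ≤ K)
    (hb : ∀ x, (b : EReal) ≤ φ x) (hM : 4 * ((φ x₀).toReal - b) ≤ M) (hmM : m * M ≤ (r / 2) ^ 2)
    (hm1 : m ≤ 1) (hm : ∀ k, P.step k ≤ m) :
    ∃ g, IsEVISeq φ (r / 2) (4 * K + 1) M T m P x g := by
  have h := hx.isSplitSolution.isEVISeq (T := T) (Δ := 0) (b := b) (M := M) hbot
    (fun _ => EReal.zero_ne_bot) h₀ EReal.zero_ne_top he (.zero hK) hr hK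
    (by simpa only [add_zero] using hb) (by simpa only [add_zero, mul_zero] using hM) hmM hm1 hm
    (by simp only [increment_zero_right, Finset.sum_const_zero, EReal.coe_zero, le_refl,
      implies_true])
  simp only [add_zero] at h
  exact ⟨_, h⟩

end IsDiscreteSolution

/-! ### Convergence -/

theorem exists_interp_eq {X : Type*} (P : TimePartition) (x : ℕ → X) {m t : ℝ}
    (hm : ∀ k, P.step k ≤ m) (ht : 0 ≤ t) :
    ∃ k, interp P x t = x k ∧ t ≤ P.t k ∧ P.t k ≤ t + m := by
  have hne : {k : ℕ | t ≤ P.t k}.Nonempty := (P.tendsto.eventually_ge_atTop t).exists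
  refine ⟨_, rfl, Nat.sInf_mem hne, ?_⟩
  rcases h : sInf {k : ℕ | t ≤ P.t k} with _ | j
  · rw [P.t_zero]
    exact add_nonneg ht ((P.step_pos 0).le.trans (hm 0))
  · have hj : P.t j < t := not_le.1 (Nat.notMem_of_lt_sInf (j.lt_succ_self.trans_eq h.symm))
    rw [P.t_succ]
    linarith [hm j]

theorem IsEVISeq.eventually_dist_interp_le {X : Type*} [MetricSpace X] (ψ : X → EReal)
    {r Λ T ρ : ℝ} (M : ℝ) (hr : 0 < r) (hΛ : 0 ≤ Λ) (hT : 0 ≤ T) (hρ : 0 < ρ) :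
    ∀ᶠ m in 𝓝[>] (0 : ℝ), ∀ (P Q : TimePartition) (z w : ℕ → X) (g f : ℕ → ℝ),
      IsEVISeq ψ r Λ M (T + 1) m P z g → IsEVISeq ψ r Λ M (T + 1) m Q w f → z 0 = w 0 →
        ∀ t ∈ Icc 0 T, dist (interp P z t) (interp Q w t) ≤ ρ := by
  filter_upwards [IsEVISeq.eventually_dist_le ψ M hr hΛ (by linarith : 0 ≤ T + 1) hρ,
    eventually_nhdsGT_lt continuous_id one_pos] with m h hm1 P Q z w g f hz hw h₀ t ht
  obtain ⟨j, hj, htj, hjt⟩ := exists_interp_eq P z hz.step_le ht.1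
  obtain ⟨k, hk, htk, hkt⟩ := exists_interp_eq Q w hw.step_le ht.1
  rw [id] at hm1
  rw [hj, hk]
  exact h P Q z w g f hz hw h₀ j k (by linarith [ht.2]) (by linarith [ht.2])
    (abs_le.2 ⟨by linarith, by linarith⟩)

/-- The partition into intervals of length `1 / (n + 1)`. -/
noncomputable def uniformPartition (n : ℕ) : TimePartition where
  t k := k * (1 / ((n : ℝ) + 1))
  t_zero := by rw [Nat.cast_zero, zero_mul]
  strictMono _ _ hij := mul_lt_mul_of_pos_right (Nat.cast_lt.2 hij) Nat.one_div_pos_of_nat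
  tendsto := tendsto_natCast_atTop_atTop.atTop_mul_const Nat.one_div_pos_of_nat

theorem mesh_uniformPartition (n : ℕ) :
    (uniformPartition n).mesh = ((1 / ((n : ℝ) + 1) : ℝ) : EReal) := by
  have hstep : ∀ k, (uniformPartition n).step k = 1 / ((n : ℝ) + 1) := fun k => by
    simp only [TimePartition.step, uniformPartition]
    push_cast
    ring
  simp only [TimePartition.mesh, hstep, ciSup_const]

theorem tendsto_mesh_uniformPartition :
    Tendsto (fun n => (uniformPartition n).mesh) atTop (𝓝 0) := by
  simp only [mesh_uniformPartition]
  exact (continuous_coe_real_ereal.tendsto 0).comp tendsto_one_div_add_atTop_nhds_zero_nat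

/-- A scheme `S`, given by its set of solutions on each partition, is Cauchy if the interpolations
of any two solutions on sufficiently fine partitions are uniformly close on bounded intervals. -/
def IsCauchyScheme {X : Type*} [MetricSpace X] (S : TimePartition → (ℕ → X) → Prop) : Prop :=
  ∀ T : ℝ, 0 < T → ∀ ρ : ℝ, 0 < ρ → ∃ η : ℝ, 0 < η ∧ ∀ (P Q : TimePartition) (z w : ℕ → X),
    P.mesh < (η : EReal) → Q.mesh < (η : EReal) → S P z → S Q w →
      ∀ t ∈ Icc 0 T, dist (interp P z t) (interp Q w t) < ρ

namespace IsCauchyScheme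

variable {X : Type*} [MetricSpace X] {S : TimePartition → (ℕ → X) → Prop} {P : ℕ → TimePartition}
  {x : ℕ → ℕ → X} {ξ : ℝ → X} {t : ℝ}

variable (hS : IsCauchyScheme S) (hP : Tendsto (fun n => (P n).mesh) atTop (𝓝 0))
  (hx : ∀ n, S (P n) (x n))
include hS hP hx

theorem cauchySeq_interp (ht : 0 ≤ t) : CauchySeq fun n => interp (P n) (x n) t := by
  refine Metric.cauchySeq_iff.2 fun ρ hρ => ?_
  obtain ⟨η, hη, hclose⟩ := hS (t + 1) (by linarith) ρ hρ
  obtain ⟨N, hN⟩ := eventually_atTop.1 (hP.eventually_lt_const (EReal.coe_pos.2 hη))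
  exact ⟨N, fun n hn k hk => hclose _ _ _ _ (hN n hn) (hN k hk) (hx n) (hx k) t
    ⟨ht, by linarith⟩⟩

variable (hξ : ∀ t, 0 ≤ t → Tendsto (fun n => interp (P n) (x n) t) atTop (𝓝 (ξ t)))
include hξ

theorem exists_dist_interp_lt {T ρ : ℝ} (hT : 0 < T) (hρ : 0 < ρ) :
    ∃ η : ℝ, 0 < η ∧ ∀ (Q : TimePartition) (z : ℕ → X), Q.mesh < (η : EReal) → S Q z →
      ∀ t ∈ Icc 0 T, dist (interp Q z t) (ξ t) < ρ := by
  obtain ⟨η, hη, hclose⟩ := hS T hT (ρ / 2) (half_pos hρ)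
  refine ⟨η, hη, fun Q z hQ hz t ht => lt_of_le_of_lt ?_ (half_lt_self hρ)⟩
  refine le_of_tendsto (tendsto_const_nhds.dist (hξ t ht.1)) ?_
  filter_upwards [hP.eventually_lt_const (EReal.coe_pos.2 hη)] with n hn
  exact (hclose _ _ _ _ hQ hn hz (hx n) t ht).le

theorem tendsto_interp {Q : ℕ → TimePartition} (hQ : Tendsto (fun n => (Q n).mesh) atTop (𝓝 0))
    {y : ℕ → ℕ → X} (hy : ∀ n, S (Q n) (y n)) (ht : 0 ≤ t) :
    Tendsto (fun n => interp (Q n) (y n) t) atTop (𝓝 (ξ t)) := by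
  refine Metric.tendsto_nhds.2 fun ρ hρ => ?_
  obtain ⟨η, hη, hclose⟩ :=
    hS.exists_dist_interp_lt hP hx hξ (by linarith : 0 < t + 1) hρ
  filter_upwards [hQ.eventually_lt_const (EReal.coe_pos.2 hη)] with n hn
  exact hclose _ _ hn (hy n) t ⟨ht, by linarith⟩

end IsCauchyScheme

/-- The scheme whose solutions are the discrete solutions for `φ₁ + φ₂` together with the solutions
of the alternating scheme. -/
def IsSchemeSolution {X : Type*} [MetricSpace X] (φ₁ φ₂ : X → EReal) (z₀ : X) (P : TimePartition)
    (z : ℕ → X) : Prop :=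
  IsDiscreteSolution (fun x => φ₁ x + φ₂ x) P z₀ z ∨ ∃ zh, IsSplitSolution φ₁ φ₂ P z₀ zh z

section Convergence

variable {X : Type*} [MetricSpace X] {φ₁ φ₂ : X → EReal} {z₀ : X} {b : ℝ}

theorem IsSchemeSolution.zero {P : TimePartition} {z : ℕ → X}
    (hz : IsSchemeSolution φ₁ φ₂ z₀ P z) : z 0 = z₀ :=
  hz.elim (·.1) fun ⟨_, h⟩ => h.1

theorem exists_isEVISeq_of_isSchemeSolution {r K T : ℝ}
    (hb₁ : ∀ x, φ₁ x ≠ ⊥) (hb₂ : ∀ x, φ₂ x ≠ ⊥) (hb : ∀ x, (b : EReal) ≤ φ₁ x + φ₂ x)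
    (hr : 0 < r) (hK : 0 ≤ K) (he₁ : HasLocalEVI φ₁ r K) (he₂ : HasLocalEVI φ₂ r K)
    (he : HasLocalEVI (fun x => φ₁ x + φ₂ x) r K) (hT : 0 < T)
    (hz₀ : φ₁ z₀ + φ₂ z₀ ≠ ⊤) (hsum : IncrementsSummable φ₁ φ₂ z₀) :
    ∃ M : ℝ, ∀ᶠ m : ℝ in 𝓝[>] 0, ∀ P : TimePartition, P.mesh < (m : EReal) →
      ∀ z, IsSchemeSolution φ₁ φ₂ z₀ P z →
        ∃ g, IsEVISeq (fun x => φ₁ x + φ₂ x) (r / 2) (4 * K + 1) M T m P z g := by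
  obtain ⟨Δ, hΔ⟩ := hsum 1 one_pos T hT
  obtain ⟨h₁, h₂⟩ := ne_top_of_add_ne_top hb₁ hb₂ hz₀
  set M := 4 * ((φ₁ z₀ + φ₂ z₀).toReal - b + 3 * max Δ 0)
  refine ⟨M, ?_⟩
  filter_upwards [eventually_nhdsGT_lt (F := fun m => m * M) (c := (r / 2) ^ 2) (by fun_prop)
    (by rw [zero_mul]; positivity), eventually_nhdsGT_lt continuous_id one_pos] with m hmM hm1
  rintro P hP z (hz | ⟨zh, hz⟩)
  · exact hz.exists_isEVISeq (add_ne_bot hb₁ hb₂) hz₀ T he hr.le hK hb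
      (by linarith [le_max_right Δ 0]) hmM.le hm1.le (TimePartition.step_le_of_mesh_le hP.le)
  · exact ⟨_, hz.isEVISeq hb₁ hb₂ h₁ h₂ he₁ he₂ hr.le hK hb
      (by linarith [le_max_left Δ 0]) hmM.le hm1.le (TimePartition.step_le_of_mesh_le hP.le)
      fun N hN => hΔ P (hP.trans (EReal.coe_lt_coe hm1)) N hN zh z hz⟩

theorem isCauchyScheme_isSchemeSolution {r K : ℝ}
    (hb₁ : ∀ x, φ₁ x ≠ ⊥) (hb₂ : ∀ x, φ₂ x ≠ ⊥) (hb : ∀ x, (b : EReal) ≤ φ₁ x + φ₂ x)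
    (hr : 0 < r) (hK : 0 ≤ K) (he₁ : HasLocalEVI φ₁ r K) (he₂ : HasLocalEVI φ₂ r K)
    (he : HasLocalEVI (fun x => φ₁ x + φ₂ x) r K)
    (hz₀ : φ₁ z₀ + φ₂ z₀ ≠ ⊤) (hsum : IncrementsSummable φ₁ φ₂ z₀) :
    IsCauchyScheme (IsSchemeSolution φ₁ φ₂ z₀) := by
  intro T hT ρ hρ
  obtain ⟨M, hM⟩ := exists_isEVISeq_of_isSchemeSolution hb₁ hb₂ hb hr hK he₁ he₂ he
    (by linarith : 0 < T + 1) hz₀ hsum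
  have hclose := IsEVISeq.eventually_dist_interp_le (fun x => φ₁ x + φ₂ x) M (half_pos hr)
    (by linarith : 0 ≤ 4 * K + 1) hT.le (half_pos hρ)
  obtain ⟨m, ⟨hM, hclose⟩, hm : 0 < m⟩ := ((hM.and hclose).and self_mem_nhdsWithin).exists
  refine ⟨m, hm, fun P Q z w hP hQ hz hw t ht => ?_⟩
  obtain ⟨g, hg⟩ := hM P hP z hz
  obtain ⟨f, hf⟩ := hM Q hQ w hw
  exact (hclose P Q z w g f hg hf (hz.zero.trans hw.zero.symm) t ht).trans_lt (half_lt_self hρ)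

theorem SublevelsCompact.exists_tendsto {φ : X → EReal} (hcpt : SublevelsCompact φ) {u : ℕ → X}
    (hu : CauchySeq u) {q : EReal} (hq : q ≠ ⊤) (hle : ∀ n, φ (u n) ≤ q) :
    ∃ y, Tendsto u atTop (𝓝 y) := by
  have hcompact : IsCompact (closure (range u)) := hcpt q.toReal _
    (range_subset_iff.2 fun n => (hle n).trans (EReal.le_coe_toReal hq)) hu.isBounded_range
  obtain ⟨y, -, hy⟩ := cauchySeq_tendsto_of_isComplete hcompact.isComplete
    (fun n => subset_closure (mem_range_self n)) hu
  exact ⟨y, hy⟩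

theorem IsCauchyScheme.exists_isGradientCurve {φ : X → EReal}
    {S : TimePartition → (ℕ → X) → Prop} (hS : IsCauchyScheme S)
    (hdS : ∀ P x, IsDiscreteSolution φ P z₀ x → S P x) (hb : ∀ x, (b : EReal) ≤ φ x)
    (hlsc : LowerSemicontinuous φ) (hcpt : SublevelsCompact φ) (hz₀ : φ z₀ ≠ ⊤) :
    ∃ ξ : ℝ → X, IsGradientCurve φ z₀ ξ ∧
      (∀ ξ' : ℝ → X, IsGradientCurve φ z₀ ξ' → ∀ t : ℝ, 0 ≤ t → ξ' t = ξ t) ∧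
      ∀ T : ℝ, 0 < T → ∀ ρ : ℝ, 0 < ρ → ∃ η : ℝ, 0 < η ∧ ∀ (P : TimePartition) (z : ℕ → X),
        P.mesh < (η : EReal) → S P z → ∀ t ∈ Icc (0 : ℝ) T, dist (interp P z t) (ξ t) < ρ := by
  choose x hx using fun n => exists_isDiscreteSolution
    (fun τ hτ => proxSet_nonempty hb hlsc hcpt hz₀ hτ) (uniformPartition n) z₀
  have hxS := fun n => hdS _ _ (hx n)
  have hmesh := tendsto_mesh_uniformPartition
  have hlim : ∀ t : ℝ, ∃ y, 0 ≤ t →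
      Tendsto (fun n => interp (uniformPartition n) (x n) t) atTop (𝓝 y) := fun t => by
    by_cases ht : 0 ≤ t
    · obtain ⟨y, hy⟩ := hcpt.exists_tendsto (hS.cauchySeq_interp hmesh hxS ht) hz₀
        fun n => (hx n).le _
      exact ⟨y, fun _ => hy⟩
    · exact ⟨z₀, fun h => absurd h ht⟩
  choose ξ hξ using hlim
  refine ⟨ξ, ⟨uniformPartition, x, hx, hmesh, hξ⟩, ?_,
    fun T hT ρ hρ => hS.exists_dist_interp_lt hmesh hxS hξ hT hρ⟩
  rintro ξ' ⟨P, y, hy, hP, hlim⟩ t ht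
  exact tendsto_nhds_unique (hlim t ht)
    (hS.tendsto_interp hmesh hxS hξ hP (fun n => hdS _ _ (hy n)) ht)

end Convergence

end TrotterKato

open TrotterKato in
theorem theorem5p1_general {X : Type*} [MetricSpace X] {φ₁ φ₂ : X → EReal} {l₁ l₂ b₁ b₂ : ℝ}
    (hb₁ : ∀ x, (b₁ : EReal) ≤ φ₁ x) (hb₂ : ∀ x, (b₂ : EReal) ≤ φ₂ x)
    (hlsc₁ : LowerSemicontinuous φ₁) (hlsc₂ : LowerSemicontinuous φ₂)
    (hcpt₁ : SublevelsCompact φ₁) (hcpt₂ : SublevelsCompact φ₂)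
    {r C : ℝ} (hr : 0 < r) {Γ : Set (ℝ → X)} (hΓ : IsVariationFamily r C Γ)
    (hconv₁ : IsLConvexAlong Γ l₁ φ₁) (hconv₂ : IsLConvexAlong Γ l₂ φ₂)
    {z₀ : X} (hz₀ : z₀ ∈ effDomain (fun x => φ₁ x + φ₂ x)) (hsum : IncrementsSummable φ₁ φ₂ z₀) :
    (∀ P : TimePartition, ∃ zh z : ℕ → X, IsSplitSolution φ₁ φ₂ P z₀ zh z) ∧
    ∃ ξ : ℝ → X,
      IsGradientCurve (fun x => φ₁ x + φ₂ x) z₀ ξ ∧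
      (∀ ξ' : ℝ → X, IsGradientCurve (fun x => φ₁ x + φ₂ x) z₀ ξ' →
        ∀ t : ℝ, 0 ≤ t → ξ' t = ξ t) ∧
      ∀ T : ℝ, 0 < T → ∀ ρ : ℝ, 0 < ρ → ∃ η : ℝ, 0 < η ∧
        ∀ P : TimePartition, P.mesh < (η : EReal) →
          ∀ zh z : ℕ → X, IsSplitSolution φ₁ φ₂ P z₀ zh z →
            ∀ t ∈ Icc (0 : ℝ) T, dist (interp P z t) (ξ t) < ρ := by
  have hbot₁ := ne_bot_of_coe_le hb₁
  have hbot₂ := ne_bot_of_coe_le hb₂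
  have hb : ∀ x, ((b₁ + b₂ : ℝ) : EReal) ≤ φ₁ x + φ₂ x := fun x => add_le_add (hb₁ x) (hb₂ x)
  obtain ⟨h₁, h₂⟩ := ne_top_of_add_ne_top hbot₁ hbot₂ hz₀
  set K := |C| + |l₁| + |l₂|
  have hevi {l : ℝ} {φ : X → EReal} (hbot : ∀ x, φ x ≠ ⊥) (hconv : IsLConvexAlong Γ l φ)
      (hl : |l| ≤ |l₁| + |l₂|) : HasLocalEVI φ r K :=
    hΓ.hasLocalEVI hbot hconv (by linarith [le_abs_self C, abs_nonneg l])
      (by linarith [neg_le_abs l, abs_nonneg C])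
  have hcauchy : IsCauchyScheme (IsSchemeSolution φ₁ φ₂ z₀) :=
    isCauchyScheme_isSchemeSolution hbot₁ hbot₂ hb hr (by positivity)
      (hevi hbot₁ hconv₁ (by linarith [abs_nonneg l₂]))
      (hevi hbot₂ hconv₂ (by linarith [abs_nonneg l₁]))
      (hevi (add_ne_bot hbot₁ hbot₂) (.add hbot₁ hbot₂ hconv₁ hconv₂) (abs_add_le l₁ l₂)) hz₀ hsum
  obtain ⟨ξ, hξ, huniq, hconv⟩ := hcauchy.exists_isGradientCurve (fun _ _ => Or.inl) hb
    (lowerSemicontinuous_add hbot₁ hbot₂ hlsc₁ hlsc₂) (hcpt₁.add hb₂) hz₀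
  refine ⟨fun P => exists_isSplitSolution (fun _ hτ => proxSet_nonempty hb₁ hlsc₁ hcpt₁ h₁ hτ)
    (fun _ hτ => proxSet_nonempty hb₂ hlsc₂ hcpt₂ h₂ hτ) P z₀, ξ, hξ, huniq, fun T hT ρ hρ => ?_⟩
  obtain ⟨η, hη, hclose⟩ := hconv T hT ρ hρ
  exact ⟨η, hη, fun P hP zh z hz => hclose P z hP (Or.inr ⟨zh, hz⟩)⟩

theorem theorem5p1 {X : Type*} [MetricSpace X] [CompleteSpace X] [BoundedSpace X]
    (φ₁ φ₂ : X → EReal) (l₁ l₂ : ℝ)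
    (hbot₁ : ∀ x, φ₁ x ≠ ⊥) (hbot₂ : ∀ x, φ₂ x ≠ ⊥)
    (hlsc₁ : LowerSemicontinuous φ₁) (hlsc₂ : LowerSemicontinuous φ₂)
    (hcpt₁ : TrotterKato.SublevelsCompact φ₁) (hcpt₂ : TrotterKato.SublevelsCompact φ₂)
    (hcase :
      (TrotterKato.IsCAT1 X ∧ TrotterKato.IsLConvex l₁ φ₁ ∧ TrotterKato.IsLConvex l₂ φ₂) ∨
      (∃ (Γ : Set (ℝ → X)) (K : ℝ), TrotterKato.IsGeodesicFamily Γ ∧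
        TrotterKato.IsCommutative Γ ∧ TrotterKato.SqDistConvexAlong Γ K ∧
        TrotterKato.IsLConvexAlong Γ l₁ φ₁ ∧ TrotterKato.IsLConvexAlong Γ l₂ φ₂))
    (z₀ : X) (hz₀ : z₀ ∈ TrotterKato.effDomain (fun x => φ₁ x + φ₂ x))
    (hsum : TrotterKato.IncrementsSummable φ₁ φ₂ z₀) :
    -- the alternating scheme is solvable for every partition
    (∀ P : TrotterKato.TimePartition,
      ∃ zh z : ℕ → X, TrotterKato.IsSplitSolution φ₁ φ₂ P z₀ zh z) ∧
    -- there is exactly one gradient curve of the sum, and the scheme converges to it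
    ∃ ξ : ℝ → X,
      TrotterKato.IsGradientCurve (fun x => φ₁ x + φ₂ x) z₀ ξ ∧
      (∀ ξ' : ℝ → X, TrotterKato.IsGradientCurve (fun x => φ₁ x + φ₂ x) z₀ ξ' →
        ∀ t : ℝ, 0 ≤ t → ξ' t = ξ t) ∧
      ∀ T : ℝ, 0 < T → ∀ ρ : ℝ, 0 < ρ → ∃ η : ℝ, 0 < η ∧
        ∀ P : TrotterKato.TimePartition, P.mesh < (η : EReal) →
          ∀ zh z : ℕ → X, TrotterKato.IsSplitSolution φ₁ φ₂ P z₀ zh z →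
            ∀ t ∈ Set.Icc (0 : ℝ) T, dist (TrotterKato.interp P z t) (ξ t) < ρ := by
  open TrotterKato in
  obtain ⟨C, Γ, hΓ, hconv₁, hconv₂⟩ := exists_isVariationFamily hcase
  obtain ⟨b₁, hb₁⟩ := hcpt₁.exists_coe_le hbot₁ hlsc₁
  obtain ⟨b₂, hb₂⟩ := hcpt₂.exists_coe_le hbot₂ hlsc₂
  exact theorem5p1_general hb₁ hb₂ hlsc₁ hlsc₂ hcpt₁ hcpt₂ one_pos hΓ hconv₁ hconv₂ hz₀ hsum
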